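/- Fix a square number $l_1\in\mathbb N$. Let $\mathcal C_1$ be a set of $N_1=2^{\sqrt{l_1}}$ binary words of length $l_1$, each of which starts with $001$ and contains $00$ only as a prefix. Given a set $\mathcal C_j$ of $N_j$ words of equal length, choose any ordering $\mathcal C_j=\{u_1,\dots,u_{N_j}\}$ and let $\mathcal C_{j+1}$ be the set of all words $u_{\pi(1)}u_{\pi(2)}\cdots u_{\pi(N_j)}$, where $\pi$ is a permutation of $\{1,\dots,N_j\}$ that fixes every index outside $\{2\}\cup\{i^2: 2\le i\le \sqrt{N_j}\}$. Let $X\subset\{0,1\}^{\mathbb Z}$ be the subshift of all bi-infinite sequences each word of which is a subword of a word in some $\mathcal C_j$. Let $\sigma$ be the left shift, and let $\mu$ be the $\sigma$-invariant Borel probability measure on $X$ (there is only one; the statement holds for any such measure). For $x\in X$ let $R_n(x)=\inf\{k>0: x_{[k,k+n)}=x_{[0,n)}\}$. A function $\varphi$ of $\beta>0$ with values in $[0,\infty]$ is said to have the critical value $c$ if $\varphi(\beta)=0$ for $\beta>c$ and $\varphi(\beta)=\infty$ for $0<\beta<c$. There is an absolute constant $L$ such that, whenever $l_1\ge L$, the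 following hold for all choices of $\mathcal C_1$ and of the orderings. (1) For $\mu$-a.e. $x\in X$, the function $\beta\mapsto\limsup_{n\to\infty}\frac{1}{n^\beta}\log R_n(x)$ has the critical value $1/2$. (2) There is a set $\hat X\subset X$ of full $\mu$-measure such that for every $\tau\in[0,1/2]$ there is a strictly increasing sequence $(n_j)_{j\in\mathbb N}$ of natural numbers such that for every $x\in\hat X$ the limit $\lim_{j\to\infty}\frac{1}{n_j^\beta}\log R_{n_j}(x)$ exists in $[0,\infty]$ for all $\beta>0$ and, as a function of $\beta$, has the critical value $\tau$. -/

import Mathlib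

open Filter Topology MeasureTheory

namespace EntropyDim

/-- Finite binary words; `false` is the symbol `0` and `true` is the symbol `1`. -/
abbrev Word := List Bool

/-- The set `{2} ∪ {i² : 2 ≤ i ≤ ⌊√N⌋}` of permuted positions; positions are counted from `1`. -/
def permutedPositions (N : ℕ) : Set ℕ :=
  {p | p = 2 ∨ ∃ i : ℕ, 2 ≤ i ∧ i ≤ Nat.sqrt N ∧ p = i ^ 2}

/-- The concatenation `u_{π(1)} u_{π(2)} ⋯ u_{π(N)}` for an ordered list `u₁, …, u_N` of words
(the entry `u_i` has the zero-based index `i - 1` in the list). -/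
def arrange (C : List Word) (π : Equiv.Perm (Fin C.length)) : Word :=
  (List.ofFn fun i : Fin C.length => C.get (π i)).flatten

/-- The words obtained from `u₁ u₂ ⋯ u_N` by permuting the subwords at the permuted positions
and leaving all the other ones fixed. -/
def rearrangements (C : List Word) : Set Word :=
  {w | ∃ π : Equiv.Perm (Fin C.length),
      (∀ i : Fin C.length, (i : ℕ) + 1 ∉ permutedPositions C.length → π i = i) ∧
      w = arrange C π}

/-- `C 0, C 1, C 2, …` are the successive word sets of the construction started with words of
length `l₁`, each one listed without repetition in an arbitrarily chosen order. -/
structure IsConstruction (l₁ : ℕ) (C : ℕ → List Word) : Prop where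
  /-- each list enumerates its word set injectively -/
  nodup : ∀ j, (C j).Nodup
  /-- the initial words have length `l₁` -/
  length_eq : ∀ u ∈ C 0, u.length = l₁
  /-- there are `2 ^ √l₁` initial words -/
  card_eq : (C 0).length = 2 ^ Nat.sqrt l₁
  /-- each initial word starts with `001` -/
  marker : ∀ u ∈ C 0, [false, false, true] <+: u
  /-- `00` occurs in an initial word only as a prefix -/
  marker_only : ∀ u ∈ C 0, ∀ a b : Word, u = a ++ [false, false] ++ b → a = []
  /-- the inductive step -/
  mem_succ : ∀ j w, w ∈ C (j + 1) ↔ w ∈ rearrangements (C j)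

/-- The word `x_i x_{i+1} ⋯ x_{i+n-1}`. -/
def window (x : ℤ → Bool) (i : ℤ) (n : ℕ) : Word :=
  List.ofFn fun k : Fin n => x (i + (k : ℕ))

/-- The set of all bi-infinite sequences each word of which is a subword of some `u ∈ C j`. -/
def subshift (C : ℕ → List Word) : Set (ℤ → Bool) :=
  {x | ∀ (i : ℤ) (n : ℕ), ∃ j, ∃ u ∈ C j, window x i n <:+: u}

/-- The left shift. -/
def shift (x : ℤ → Bool) : ℤ → Bool := fun i => x (i + 1)

/-- The first return time `inf {k > 0 : x_{[k,k+n)} = x_{[0,n)}}`, equal to `⊤` if there is no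
such `k`. -/
noncomputable def returnTime (n : ℕ) (x : ℤ → Bool) : ℕ∞ :=
  ⨅ (k : ℕ) (_ : 0 < k ∧ window x k n = window x 0 n), (k : ℕ∞)

/-- The quantity `(log R_n(x)) / n ^ β`, as an extended real number. -/
noncomputable def returnRate (β : ℝ) (n : ℕ) (x : ℤ → Bool) : EReal :=
  ENNReal.log (returnTime n x : ENNReal) / (((n : ℝ) ^ β : ℝ) : EReal)

/-- `c` is the critical value of the function `φ` of the parameter `β > 0`:
`φ β = 0` for `β > c` and `φ β = ∞` for `β < c`. -/
def HasCriticalValue (φ : ℝ → EReal) (c : ℝ) : Prop :=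
  (∀ β : ℝ, 0 < β → c < β → φ β = 0) ∧ (∀ β : ℝ, 0 < β → β < c → φ β = ⊤)

end EntropyDim

namespace EntropyDim

/-! ### Windows -/

/-! Write `N_j` and `l_j` for the number and the length of the words of `C j`. The permuted
positions number `⌊√N_j⌋`, so `N_{j+1} = ⌊√N_j⌋!` and `log N_{j+1}` is `√N_j · log N_j` up to a
factor between 1/8 and 1/2, while `√l_{j+1} = √N_j · √l_j`. Hence `log N_j / √l_j` lies between
`8^{-j}/2` and `2^{-j}`. As `log l_j ≥ 2^j`, the power `8^j` is negligible against every positive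
power of `l_j`, and `log l_{j+1} = l_j^{1/2+o(1)}`.

Words of `C j` occur in a point exactly along a progression of step `l_j` (`exists_parse`). The
squares are sparse, so by Borel–Cantelli almost every point eventually sees only unpermuted blocks
over about `N_j^{1/4}` blocks after the origin (`ae_eventually_steady`). Then `R_n = l_{j+1}`
exactly for `2 l_j ≤ n ≤ N_j^{1/4} l_j` (`returnTime_eq_of_steady`): unpermuted blocks recur in the
next word of level `j + 1`, and nowhere earlier. This range of `n` reaches beyond any fixed power of
`l_j`. With `n_j ≈ l_j^{1/(2τ)}` the quotient `log R_n / n^β` behaves like `l_j^{1/2-β/(2τ)}`, which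
gives part (2), and with `τ = 1/2` the lower half of part (1).

For the upper half, `m` consecutive blocks contain only `O(√m)` permuted ones, so there are at most
`exp(10√n)` windows of length `n` (`exists_window_cover_log_le`). A recurrence estimate and
Borel–Cantelli then give `log R_n ≤ 14√n` almost surely (`ae_eventually_log_returnTime_le`). -/

@[simp] lemma length_window (x : ℤ → Bool) (i : ℤ) (n : ℕ) : (window x i n).length = n := by
  simp [window]

lemma window_eq_window_iff {x y : ℤ → Bool} {i j : ℤ} {n : ℕ} :
    window x i n = window y j n ↔ ∀ k : ℕ, k < n → x (i + k) = y (j + k) := by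
  unfold window
  rw [List.ofFn_inj, funext_iff]
  exact ⟨fun h k hk => h ⟨k, hk⟩, fun h k => h k k.2⟩

lemma window_eq_iff {x : ℤ → Bool} {i : ℤ} {n : ℕ} {w : Word} (hw : w.length = n) :
    window x i n = w ↔ ∀ (k : ℕ) (hk : k < n), x (i + k) = w[k]'(hw ▸ hk) := by
  subst hw
  constructor
  · intro h k hk
    have := List.getElem_of_eq h (i := k) (by simpa using hk)
    simpa [window] using this
  · intro h
    apply List.ext_getElem
    · simp
    · intro k hk hk'
      simpa [window] using h k hk'

lemma apply_of_window_eq {x : ℤ → Bool} {i : ℤ} {n : ℕ} {w : Word} (h : window x i n = w) {k : ℕ}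
    (hk : k < w.length) : x (i + k) = w[k] := by
  have hw : w.length = n := by rw [← h]; simp
  exact (window_eq_iff hw).1 h k (hw ▸ hk)

lemma window_congr {x y : ℤ → Bool} {i : ℤ} {n : ℕ} (h : ∀ t, i ≤ t → t < i + n → x t = y t) :
    window x i n = window y i n :=
  window_eq_window_iff.2 fun k hk => h _ (by omega) (by omega)

lemma window_shift_iterate (x : ℤ → Bool) (p : ℕ) (i : ℤ) (n : ℕ) :
    window (shift^[p] x) i n = window x (i + p) n := by
  have : ∀ (p : ℕ) (x : ℤ → Bool) (t : ℤ), shift^[p] x t = x (t + p) := by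
    intro p
    induction p with
    | zero => simp
    | succ p ih => intro x t; rw [Function.iterate_succ_apply, ih, shift]; push_cast; ring_nf
  rw [window_eq_window_iff]
  intro k _
  rw [this]
  ring_nf

lemma window_mul (x : ℤ → Bool) (k : ℤ) (N l : ℕ) :
    window x k (N * l) = (List.ofFn fun i : Fin N => window x (k + (i * l : ℕ)) l).flatten := by
  unfold window
  rw [List.ofFn_mul]
  congr 2
  funext i
  congr 1
  funext j
  push_cast
  ring_nf

lemma flatten_ofFn_inj {α : Type*} {N l : ℕ} {f g : Fin N → List α} (hf : ∀ i, (f i).length = l)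
    (hg : ∀ i, (g i).length = l) :
    (List.ofFn f).flatten = (List.ofFn g).flatten ↔ f = g := by
  refine ⟨fun h => ?_, fun h => h ▸ rfl⟩
  refine List.ofFn_injective (List.eq_iff_flatten_eq.2 ⟨h, ?_⟩)
  simp only [List.map_ofFn]
  congr 1
  funext i
  simp [hf, hg]

section arrange

variable {D : List Word} {l : ℕ}

lemma window_eq_arrange_iff (hD : ∀ u ∈ D, u.length = l) {x : ℤ → Bool} {k : ℤ}
    {π : Equiv.Perm (Fin D.length)} :
    window x k (D.length * l) = arrange D π ↔
      ∀ i : Fin D.length, window x (k + (i * l : ℕ)) l = D.get (π i) := by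
  rw [window_mul, arrange, flatten_ofFn_inj (l := l), funext_iff]
  · simp
  · exact fun i => hD _ (List.get_mem _ _)

lemma length_arrange (hD : ∀ u ∈ D, u.length = l) (π : Equiv.Perm (Fin D.length)) :
    (arrange D π).length = D.length * l := by
  rw [arrange, List.length_flatten, List.map_ofFn]
  have : (List.length ∘ fun i => D.get (π i)) = fun _ => l := by
    funext i
    exact hD _ (List.get_mem _ _)
  rw [this, List.sum_ofFn]
  simp

lemma arrange_injective (hD : ∀ u ∈ D, u.length = l) (hn : D.Nodup) :
    Function.Injective (arrange D) := by
  intro π π' h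
  rw [arrange, arrange, flatten_ofFn_inj (l := l) (fun i => hD _ (List.get_mem _ _))
    (fun i => hD _ (List.get_mem _ _))] at h
  ext i
  exact congrArg _ (hn.injective_get (congrFun h i))

end arrange

/-! ### Counting the permuted positions. -/

/-- Since position 1 is excluded, every word of the next level starts with the same word `u₁`, which
serves as its marker in the recognizability argument. -/
lemma one_notMem_permutedPositions (N : ℕ) : 1 ∉ permutedPositions N := by
  rintro (h | ⟨i, hi, -, h⟩)
  · omega
  · nlinarith

-- Position 2 takes the place of the missing square 1, so the count is exactly `⌊√N⌋`.
open Classical in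
lemma card_permutedPositions {N : ℕ} (hN : 2 ≤ N) :
    Fintype.card {i : Fin N // (i : ℕ) + 1 ∈ permutedPositions N} = Nat.sqrt N := by
  rw [← Fintype.card_fin (Nat.sqrt N)]
  have hs : 1 ≤ Nat.sqrt N := Nat.le_sqrt.2 (by omega)
  have hs2 : ∀ i, i ≤ Nat.sqrt N → i ^ 2 ≤ N := fun i hi => Nat.le_sqrt'.1 hi
  symm
  refine Fintype.card_of_bijective
    (f := fun k : Fin (Nat.sqrt N) => if hk : (k : ℕ) = 0 then ⟨⟨1, by omega⟩, Or.inl rfl⟩ else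
      ⟨⟨((k : ℕ) + 1) ^ 2 - 1, ?_⟩, ?_⟩) ⟨?_, ?_⟩
  · have := hs2 (k + 1) k.2
    omega
  · refine Or.inr ⟨k + 1, by omega, k.2, ?_⟩
    have : 0 < ((k : ℕ) + 1) ^ 2 := by positivity
    simp only
    omega
  · intro a b hab
    have h1 : 0 < ((a : ℕ) + 1) ^ 2 := by positivity
    have h2 : 0 < ((b : ℕ) + 1) ^ 2 := by positivity
    ext
    dsimp only at hab
    split_ifs at hab with h3 h4 h4
    · omega
    · have := congrArg (fun z => z.1.1) hab
      simp only at this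
      have : 2 ≤ (b : ℕ) + 1 := by omega
      have : 2 ^ 2 ≤ ((b : ℕ) + 1) ^ 2 := Nat.pow_le_pow_left this 2
      omega
    · have := congrArg (fun z => z.1.1) hab
      simp only at this
      have : 2 ≤ (a : ℕ) + 1 := by omega
      have : 2 ^ 2 ≤ ((a : ℕ) + 1) ^ 2 := Nat.pow_le_pow_left this 2
      omega
    · have := congrArg (fun z => z.1.1) hab
      simp only at this
      have : ((a : ℕ) + 1) ^ 2 = ((b : ℕ) + 1) ^ 2 := by omega
      have := Nat.pow_left_injective (n := 2) (by norm_num) this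
      omega
  · rintro ⟨⟨p, hp⟩, h | ⟨i, hi, hi', h⟩⟩
    · refine ⟨⟨0, by omega⟩, ?_⟩
      simp only at h
      simp only [dite_true]
      ext
      simp only
      omega
    · refine ⟨⟨i - 1, by omega⟩, ?_⟩
      simp only at h
      have : i - 1 ≠ 0 := by omega
      simp only [this, dite_false]
      ext
      simp only
      have : i - 1 + 1 = i := by omega
      rw [this, ← h]
      rfl

/-! ### The block structure -/

/-- The common length of the words of `C j`. -/
def blockLength (l₁ : ℕ) (C : ℕ → List Word) : ℕ → ℕ
  | 0 => l₁
  | j + 1 => (C j).length * blockLength l₁ C j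

lemma blockLength_succ (l₁ : ℕ) (C : ℕ → List Word) (j : ℕ) :
    blockLength l₁ C (j + 1) = (C j).length * blockLength l₁ C j := rfl

namespace IsConstruction

variable {l₁ : ℕ} {C : ℕ → List Word}

lemma length_of_mem (h : IsConstruction l₁ C) (j : ℕ) : ∀ u ∈ C j, u.length = blockLength l₁ C j := by
  induction j with
  | zero => exact h.length_eq
  | succ j ih =>
    intro u hu
    obtain ⟨π, -, rfl⟩ := (h.mem_succ j u).1 hu
    exact length_arrange ih π

/-- Admissible permutations are the permutations of the permuted positions, and distinct ones give
distinct words because the list has no repetition. -/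
lemma length_succ (h : IsConstruction l₁ C) {j : ℕ} (hj : 2 ≤ (C j).length) :
    (C (j + 1)).length = (Nat.sqrt (C j).length).factorial := by
  classical
  have e := Equiv.Perm.subtypeEquivSubtypePerm
    (fun i : Fin (C j).length => (i : ℕ) + 1 ∈ permutedPositions (C j).length)
  rw [← card_permutedPositions hj, ← Fintype.card_perm, Fintype.card_congr e,
    ← List.toFinset_card_of_nodup (h.nodup (j + 1)), Fintype.card_subtype,
    ← Finset.card_image_of_injective _ (arrange_injective (h.length_of_mem j) (h.nodup j))]
  congr 1
  ext w
  rw [List.mem_toFinset, h.mem_succ]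
  simp [rearrangements, eq_comm]

lemma window_mem_succ_iff (h : IsConstruction l₁ C) (j : ℕ) (x : ℤ → Bool) (k : ℤ) :
    window x k (blockLength l₁ C (j + 1)) ∈ C (j + 1) ↔
      ∃ π : Equiv.Perm (Fin (C j).length),
        (∀ i : Fin (C j).length, (i : ℕ) + 1 ∉ permutedPositions (C j).length → π i = i) ∧
        ∀ i : Fin (C j).length,
          window x (k + (i * blockLength l₁ C j : ℕ)) (blockLength l₁ C j) = (C j).get (π i) := by
  rw [h.mem_succ]
  simp only [rearrangements, Set.mem_ofPred_eq, blockLength_succ,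
    window_eq_arrange_iff (h.length_of_mem j)]

end IsConstruction

/-! ### Recognizability -/

namespace IsConstruction

variable {l₁ : ℕ} {C : ℕ → List Word}

lemma three_le (h : IsConstruction l₁ C) : 3 ≤ l₁ := by
  have hc : 0 < (C 0).length := by rw [h.card_eq]; positivity
  have hu := List.getElem_mem hc
  simpa [h.length_eq _ hu] using (h.marker _ hu).length_le

lemma blockLength_pos (h : IsConstruction l₁ C) (hN : ∀ j, 2 ≤ (C j).length) (j : ℕ) :
    0 < blockLength l₁ C j := by
  induction j with
  | zero => exact lt_of_lt_of_le (by norm_num) h.three_le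
  | succ j ih => exact Nat.mul_pos (lt_of_lt_of_le (by norm_num) (hN j)) ih

/-- The first word in the list is never moved. -/
lemma fixes_zero {N : ℕ} {π : Equiv.Perm (Fin N)}
    (hπ : ∀ i : Fin N, (i : ℕ) + 1 ∉ permutedPositions N → π i = i) (i : Fin N)
    (hi : (i : ℕ) = 0) : π i = i :=
  hπ i (by rw [hi]; exact one_notMem_permutedPositions N)

lemma initial_apply (h : IsConstruction l₁ C) {x : ℤ → Bool} {k : ℤ}
    (hk : window x k l₁ ∈ C 0) : x k = false ∧ x (k + 1) = false ∧ x (k + 2) = true := by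
  have h3 := h.three_le
  have hp := h.marker _ hk
  have hg : ∀ (i : ℕ) (hi : i < 3), x (k + i) = [false, false, true][i]'(by simpa using hi) := by
    intro i hi
    rw [hp.getElem (by simpa using hi)]
    exact apply_of_window_eq rfl (by simp; omega)
  exact ⟨by simpa using hg 0 (by norm_num), by simpa using hg 1 (by norm_num),
    by simpa using hg 2 (by norm_num)⟩

lemma initial_not_zeros (h : IsConstruction l₁ C) {x : ℤ → Bool} {k : ℤ}
    (hk : window x k l₁ ∈ C 0) {r : ℕ} (hr : 0 < r) (hr' : r + 2 ≤ l₁)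
    (h0 : x (k + r) = false) (h1 : x (k + r + 1) = false) : False := by
  set u := window x k l₁ with hu
  have hlen : u.length = l₁ := by simp [hu]
  have e0 : u[r]'(by omega) = false := by
    rw [← h0]; exact (apply_of_window_eq hu.symm (by omega)).symm
  have e1 : u[r + 1]'(by omega) = false := by
    rw [← h1, ← apply_of_window_eq hu.symm (by omega)]; push_cast; ring_nf
  have := h.marker_only u hk (u.take r) (u.drop (r + 2)) (by
    conv_lhs => rw [← List.take_append_drop r u, List.drop_eq_getElem_cons (by omega),
      List.drop_eq_getElem_cons (by omega), e0, e1]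
    simp)
  have := congrArg List.length this
  rw [List.length_take, List.length_nil] at this
  omega

/-- Recognizability inside a concatenation of words. At the bottom level `001` can only start where
an initial word starts. At a higher level, an occurrence begins with `u₁`, hence is aligned with the
lower blocks by induction, and `u₁` stands only in the first place of a word. -/
lemma dvd_of_window_mem (h : IsConstruction l₁ C) (hN : ∀ j, 2 ≤ (C j).length) (j : ℕ) :
    ∀ (y : ℤ → Bool) (a : ℤ) (M : ℕ),
      (∀ i, i < M → window y (a + (i * blockLength l₁ C j : ℕ)) (blockLength l₁ C j) ∈ C j) →
      ∀ k : ℕ, k + blockLength l₁ C j ≤ M * blockLength l₁ C j →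
        window y (a + k) (blockLength l₁ C j) ∈ C j → blockLength l₁ C j ∣ k := by
  induction j with
  | zero =>
    intro y a M hM k hk hw
    have h3 := h.three_le
    change ∀ i, i < M → window y (a + (i * l₁ : ℕ)) l₁ ∈ C 0 at hM
    change k + l₁ ≤ M * l₁ at hk
    change window y (a + k) l₁ ∈ C 0 at hw
    change l₁ ∣ k
    obtain ⟨g0, g1, g2⟩ := h.initial_apply hw
    have hkd := Nat.div_add_mod k l₁
    have hr : k % l₁ < l₁ := Nat.mod_lt _ (by omega)
    set q := k / l₁
    set r := k % l₁ with hrdef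
    have hqM : q < M := by
      by_contra hc
      have : M * l₁ ≤ l₁ * q := by rw [mul_comm l₁]; exact Nat.mul_le_mul_right _ (by omega)
      omega
    by_contra hdvd
    have hr0 : 0 < r := Nat.pos_of_ne_zero fun h0 => hdvd (Nat.dvd_of_mod_eq_zero h0)
    have hcast : (a + k : ℤ) = a + (q * l₁ : ℕ) + r := by rw [← hkd]; push_cast; ring
    rw [hcast] at g0 g1 g2
    by_cases hr2 : r + 2 ≤ l₁
    · exact h.initial_not_zeros (hM q hqM) hr0 hr2 g0 g1
    -- The pair `00` could still straddle two words; but then the letter after it is the second `0`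
    -- of the next word, against the `1` in `001`.
    · have hrl : r + 1 = l₁ := by omega
      have hq1 : q + 1 < M := by
        by_contra hc
        have : M * l₁ ≤ (q + 1) * l₁ := Nat.mul_le_mul_right _ (by omega)
        have : (q + 1) * l₁ = l₁ * q + l₁ := by ring
        omega
      obtain ⟨-, f1, -⟩ := h.initial_apply (hM (q + 1) hq1)
      have : (a + ((q + 1) * l₁ : ℕ) + 1 : ℤ) = a + (q * l₁ : ℕ) + r + 2 := by
        have : (l₁ : ℤ) = r + 1 := by exact_mod_cast hrl.symm
        push_cast
        linear_combination this
      rw [this, g2] at f1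
      exact absurd f1 (by simp)
  | succ j ih =>
    intro y a M hM k hk hw
    have hNj := hN j
    have hl := h.blockLength_pos hN j
    rw [blockLength_succ] at hk ⊢
    simp only [h.window_mem_succ_iff] at hM hw
    simp only [blockLength_succ] at hM
    have hM' : ∀ i, i < M * (C j).length →
        window y (a + (i * blockLength l₁ C j : ℕ)) (blockLength l₁ C j) ∈ C j := by
      intro i hi
      have hq : i / (C j).length < M := Nat.div_lt_of_lt_mul (by rwa [mul_comm] at hi)
      obtain ⟨π, -, hπ⟩ := hM _ hq
      have hr : i % (C j).length < (C j).length := Nat.mod_lt _ (by omega)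
      have := hπ ⟨_, hr⟩
      have e : (a + (i * blockLength l₁ C j : ℕ) : ℤ) =
          a + (i / (C j).length * ((C j).length * blockLength l₁ C j) : ℕ) +
            (i % (C j).length * blockLength l₁ C j : ℕ) := by
        conv_lhs => rw [← Nat.div_add_mod i (C j).length]
        push_cast
        ring
      rw [e, this]
      exact List.get_mem _ _
    obtain ⟨ρ, hρ, hρ'⟩ := hw
    have hfirst := hρ' ⟨0, by omega⟩
    rw [fixes_zero hρ _ rfl] at hfirst
    simp only [zero_mul, Nat.cast_zero, add_zero] at hfirst
    have hle : blockLength l₁ C j ≤ (C j).length * blockLength l₁ C j :=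
      Nat.le_mul_of_pos_left _ (by omega)
    obtain ⟨b, rfl⟩ := ih y a (M * (C j).length) hM' k (by rw [mul_assoc]; omega)
      (by rw [hfirst]; exact List.get_mem _ _)
    have hb : b < M * (C j).length := by
      by_contra hc
      have : M * (C j).length * blockLength l₁ C j ≤ b * blockLength l₁ C j :=
        Nat.mul_le_mul_right _ (by omega)
      rw [mul_comm b, mul_assoc] at this
      omega
    have hq : b / (C j).length < M := Nat.div_lt_of_lt_mul (by rwa [mul_comm] at hb)
    have hr : b % (C j).length < (C j).length := Nat.mod_lt _ (by omega)
    obtain ⟨π, hπ, hπ'⟩ := hM _ hq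
    have hlast := hπ' ⟨_, hr⟩
    have e : (a + (blockLength l₁ C j * b : ℕ) : ℤ) =
        a + (b / (C j).length * ((C j).length * blockLength l₁ C j) : ℕ) +
          (b % (C j).length * blockLength l₁ C j : ℕ) := by
      conv_lhs => rw [← Nat.div_add_mod b (C j).length]
      push_cast
      ring
    rw [← e, hfirst] at hlast
    have h0 := (h.nodup j).injective_get hlast
    have h1 := congrArg Fin.val (π.injective ((fixes_zero hπ _ rfl).trans h0))
    simp only at h1
    rw [mul_comm (C j).length]
    exact Nat.mul_dvd_mul_left _ (Nat.dvd_of_mod_eq_zero h1.symm)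

lemma blocks_of_le (h : IsConstruction l₁ C) (j : ℕ) {J : ℕ}
    (hJ : j ≤ J) : ∃ M, blockLength l₁ C J = M * blockLength l₁ C j ∧
      ∀ (y : ℤ → Bool) (s : ℤ), window y s (blockLength l₁ C J) ∈ C J →
        ∀ i, i < M → window y (s + (i * blockLength l₁ C j : ℕ)) (blockLength l₁ C j) ∈ C j := by
  induction J, hJ using Nat.le_induction with
  | base =>
    refine ⟨1, by simp, fun y s hs i hi => ?_⟩
    obtain rfl : i = 0 := by omega
    simpa using hs
  | succ J hJ ih =>
    obtain ⟨M, hM, ih⟩ := ih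
    refine ⟨(C J).length * M, by rw [blockLength_succ, hM, mul_assoc], fun y s hs i hi => ?_⟩
    obtain ⟨π, -, hπ⟩ := (h.window_mem_succ_iff J y s).1 hs
    have hM0 : 0 < M := Nat.pos_of_ne_zero fun h0 => by simp [h0] at hi
    have hq : i / M < (C J).length := Nat.div_lt_of_lt_mul (by rwa [mul_comm] at hi)
    have h1 := hπ ⟨_, hq⟩
    have h2 := ih y _ (h1 ▸ List.get_mem (C J) _) (i % M) (Nat.mod_lt _ hM0)
    convert h2 using 2
    simp only [hM]
    conv_lhs => rw [← Nat.div_add_mod i M]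
    push_cast
    ring

lemma exists_infix_succ (h : IsConstruction l₁ C) {j : ℕ} {u : Word} (hu : u ∈ C j) :
    ∃ v ∈ C (j + 1), u <:+: v := by
  refine ⟨arrange (C j) 1, (h.mem_succ _ _).2 ⟨1, fun _ _ => rfl, rfl⟩, ?_⟩
  obtain ⟨i, rfl⟩ := List.mem_iff_get.1 hu
  exact List.infix_of_mem_flatten (List.mem_ofFn.2 ⟨i, rfl⟩)

lemma exists_infix_of_le (h : IsConstruction l₁ C) {j J : ℕ} (hJ : j ≤ J) {u : Word}
    (hu : u ∈ C j) : ∃ v ∈ C J, u <:+: v := by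
  induction J, hJ using Nat.le_induction with
  | base => exact ⟨u, hu, List.infix_rfl⟩
  | succ J hJ ih =>
    obtain ⟨v, hv, huv⟩ := ih
    obtain ⟨w, hw, hvw⟩ := h.exists_infix_succ hv
    exact ⟨w, hw, huv.trans hvw⟩

/-- A finite piece of `x` is completed to a whole word of high level. The auxiliary sequence `y` has
default values outside that word, where they are never used. -/
lemma exists_extension (h : IsConstruction l₁ C) {x : ℤ → Bool} (hx : x ∈ subshift C) (j : ℕ)
    (a : ℤ) (n : ℕ) : ∃ J, j ≤ J ∧ ∃ (s : ℤ) (y : ℤ → Bool), s ≤ a ∧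
      a + n ≤ s + blockLength l₁ C J ∧ (∀ t, a ≤ t → t < a + n → x t = y t) ∧
      window y s (blockLength l₁ C J) ∈ C J := by
  obtain ⟨i, u, hu, hw⟩ := hx a n
  obtain ⟨v, hv, huv⟩ := h.exists_infix_of_le (le_max_left i j) hu
  obtain ⟨p, q, hpq⟩ := hw.trans huv
  have hlen := h.length_of_mem _ v hv
  have hlen' : p.length + n + q.length = v.length := by
    rw [← hpq]; simp [add_assoc]
  refine ⟨max i j, le_max_right _ _, a - p.length,
    fun t => v.getD (t - (a - p.length)).toNat false, by omega, by omega, ?_, ?_⟩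
  · intro t ht ht'
    have e : (t - (a - p.length)).toNat = p.length + (t - a).toNat := by omega
    have hlt : (t - a).toNat < n := by omega
    simp only [e]
    subst hpq
    rw [List.append_assoc, List.getD_append_right _ _ _ _ (by omega), Nat.add_sub_cancel_left,
      List.getD_append _ _ _ _ (by simpa using hlt), List.getD_eq_getElem _ _ (by simpa using hlt),
      ← apply_of_window_eq (x := x) (i := a) (n := n) rfl (by simpa using hlt)]
    congr 1
    omega
  · convert hv
    rw [window_eq_iff hlen]
    intro k hk
    have e : (a - p.length + k - (a - p.length) : ℤ).toNat = k := by omega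
    simp only [e]
    rw [List.getD_eq_getElem]

lemma exists_local_parse (h : IsConstruction l₁ C) (hN : ∀ j, 2 ≤ (C j).length) {x : ℤ → Bool}
    (hx : x ∈ subshift C) (j : ℕ) (a : ℤ) (n : ℕ) :
    ∃ s : ℤ, ∀ k : ℤ, a ≤ k → k + blockLength l₁ C j ≤ a + n →
      (window x k (blockLength l₁ C j) ∈ C j ↔ (blockLength l₁ C j : ℤ) ∣ k - s) := by
  obtain ⟨J, hJ, s, y, hs, hs', hxy, hy⟩ := h.exists_extension hx j a n
  obtain ⟨M, hM, hb⟩ := h.blocks_of_le j hJ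
  have hb := hb y s hy
  have hl := h.blockLength_pos hN j
  refine ⟨s, fun k hk hk' => ?_⟩
  rw [window_congr (y := y) fun t ht ht' => hxy t (by omega) (by omega)]
  obtain ⟨d, rfl⟩ : ∃ d : ℕ, k = s + d := ⟨(k - s).toNat, by omega⟩
  rw [add_sub_cancel_left, Int.natCast_dvd_natCast]
  constructor
  · refine h.dvd_of_window_mem hN j y s M hb d ?_
    rw [← hM]
    omega
  · rintro ⟨b, rfl⟩
    rw [mul_comm]
    refine hb b ?_
    rw [hM] at hs'
    have h1 : (blockLength l₁ C j * b + blockLength l₁ C j : ℤ) ≤ M * blockLength l₁ C j := by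
      push_cast at hk' hs'
      linarith
    have h2 : blockLength l₁ C j * b + blockLength l₁ C j ≤ M * blockLength l₁ C j := by
      exact_mod_cast h1
    by_contra hc
    have : M * blockLength l₁ C j ≤ b * blockLength l₁ C j := Nat.mul_le_mul_right _ (by omega)
    rw [mul_comm b] at this
    omega

/-- The words of `C j` occur in a point of the subshift exactly along an arithmetic progression. -/
lemma exists_parse (h : IsConstruction l₁ C) (hN : ∀ j, 2 ≤ (C j).length) {x : ℤ → Bool}
    (hx : x ∈ subshift C) (j : ℕ) :
    ∃ s : ℤ, ∀ k : ℤ,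
      window x k (blockLength l₁ C j) ∈ C j ↔ (blockLength l₁ C j : ℤ) ∣ k - s := by
  have hl := h.blockLength_pos hN j
  set l := blockLength l₁ C j
  obtain ⟨s, hs⟩ := h.exists_local_parse hN hx j 0 (2 * l)
  refine ⟨s, fun k => ?_⟩
  obtain ⟨s', hs'⟩ := h.exists_local_parse hN hx j (-|k|) (2 * k.natAbs + 2 * l)
  have habs : (k.natAbs : ℤ) = |k| := Int.natCast_natAbs k
  have h1 := neg_abs_le k
  have h2 := le_abs_self k
  have h0 := abs_nonneg k
  push_cast at hs' hs
  rw [hs' k h1 (by linarith)]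
  -- The representative of `s` in `[0, l)` lies in both intervals, so it forces the two local phases
  -- to agree modulo `l`.
  have hr := Int.emod_lt_of_pos s (show (0 : ℤ) < l by exact_mod_cast hl)
  have hr0 := Int.emod_nonneg s (show (l : ℤ) ≠ 0 by exact_mod_cast hl.ne')
  have hd : (l : ℤ) ∣ s % l - s := (Int.mod_modEq s l).symm.dvd
  have hd' := (hs' (s % l) (by linarith) (by linarith)).1
    ((hs (s % l) hr0 (by linarith)).2 hd)
  have hss : (l : ℤ) ∣ s - s' := by
    rw [show s - s' = (s % l - s') - (s % l - s) by ring]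
    exact dvd_sub hd' hd
  constructor
  · intro hk
    rw [show k - s = (k - s') - (s - s') by ring]
    exact dvd_sub hk hss
  · intro hk
    rw [show k - s' = (k - s) + (s - s') by ring]
    exact dvd_add hk hss

end IsConstruction

/-! ### Return times of points in steady position -/

/-- The origin lies in a word of `C (j + 1)`, and the word of `C j` containing it, as well as the
`W` following ones, have unpermuted positions in that word. -/
def Steady (l₁ : ℕ) (C : ℕ → List Word) (j W : ℕ) (x : ℤ → Bool) : Prop :=
  ∃ t : ℕ, window x (-t) (blockLength l₁ C (j + 1)) ∈ C (j + 1) ∧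
    ∀ b, t / blockLength l₁ C j ≤ b → b ≤ t / blockLength l₁ C j + W →
      b < (C j).length ∧ b + 1 ∉ permutedPositions (C j).length

namespace IsConstruction

variable {l₁ : ℕ} {C : ℕ → List Word}

lemma window_of_unpermuted (h : IsConstruction l₁ C) {j : ℕ} {x : ℤ → Bool} {p : ℤ}
    (hp : window x p (blockLength l₁ C (j + 1)) ∈ C (j + 1)) {b : ℕ} (hb : b < (C j).length)
    (hb' : b + 1 ∉ permutedPositions (C j).length) :
    window x (p + (b * blockLength l₁ C j : ℕ)) (blockLength l₁ C j) = (C j).get ⟨b, hb⟩ := by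
  obtain ⟨π, hπ, hπ'⟩ := (h.window_mem_succ_iff j x p).1 hp
  have := hπ' ⟨b, hb⟩
  rwa [hπ ⟨b, hb⟩ hb'] at this

lemma index_eq_of_unpermuted (h : IsConstruction l₁ C) {j : ℕ} {x : ℤ → Bool} {p : ℤ}
    (hp : window x p (blockLength l₁ C (j + 1)) ∈ C (j + 1)) {b r : ℕ} (hb : b < (C j).length)
    (hb' : b + 1 ∉ permutedPositions (C j).length) (hr : r < (C j).length)
    (hw : window x (p + (r * blockLength l₁ C j : ℕ)) (blockLength l₁ C j) =
      (C j).get ⟨b, hb⟩) : r = b := by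
  obtain ⟨π, hπ, hπ'⟩ := (h.window_mem_succ_iff j x p).1 hp
  have h1 := hπ' ⟨r, hr⟩
  rw [hw] at h1
  have h2 := (h.nodup j).injective_get h1
  rw [← hπ ⟨b, hb⟩ hb'] at h2
  exact (congrArg Fin.val (π.injective h2)).symm

/-- All blocks met by the window are unpermuted, so the following word of level `j + 1` repeats them
in the same places. -/
lemma returnTime_le_of_steady (h : IsConstruction l₁ C) (hN : ∀ j, 2 ≤ (C j).length)
    {x : ℤ → Bool} (hx : x ∈ subshift C) {j W n : ℕ} (hs : Steady l₁ C j W x)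
    (hn : n ≤ W * blockLength l₁ C j) :
    returnTime n x ≤ blockLength l₁ C (j + 1) := by
  obtain ⟨t, ht, hb⟩ := hs
  refine iInf₂_le (blockLength l₁ C (j + 1)) ⟨h.blockLength_pos hN _, ?_⟩
  have hl := h.blockLength_pos hN j
  obtain ⟨s, hs⟩ := h.exists_parse hN hx (j + 1)
  have ht' : window x (-t + blockLength l₁ C (j + 1)) (blockLength l₁ C (j + 1)) ∈ C (j + 1) := by
    rw [hs] at ht ⊢
    rw [add_sub_right_comm]
    exact dvd_add_self_right.2 ht
  set l := blockLength l₁ C j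
  rw [window_eq_window_iff]
  intro k hk
  have hdm := Nat.div_add_mod (t + k) l
  have ho := Nat.mod_lt (t + k) hl
  have hb1 : t / l ≤ (t + k) / l := Nat.div_le_div_right (by omega)
  have hb2 : (t + k) / l ≤ t / l + W := by
    rw [← Nat.add_mul_div_right _ _ hl]
    exact Nat.div_le_div_right (by omega)
  obtain ⟨hbN, hbP⟩ := hb _ hb1 hb2
  have e1 := h.window_of_unpermuted ht hbN hbP
  have e2 := h.window_of_unpermuted ht' hbN hbP
  have := window_eq_window_iff.1 (e2.trans e1.symm) _ ho
  convert this using 2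
  · zify at hdm; push_cast; linear_combination -hdm
  · zify at hdm; push_cast; linear_combination -hdm

/-- A window of length at least `2 l_j` contains the whole block after the one at the origin. At a
return this unpermuted block recurs, aligned by recognizability and in its own place in a word, so
the return time is a multiple of `l_{j+1}`. -/
lemma le_returnTime_of_steady (h : IsConstruction l₁ C) (hN : ∀ j, 2 ≤ (C j).length)
    {x : ℤ → Bool} (hx : x ∈ subshift C) {j W n : ℕ} (hs : Steady l₁ C j W x) (hW : 1 ≤ W)
    (hn : 2 * blockLength l₁ C j ≤ n) :
    (blockLength l₁ C (j + 1) : ℕ∞) ≤ returnTime n x := by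
  obtain ⟨t, ht, hb⟩ := hs
  refine le_iInf₂ fun k hk => ?_
  obtain ⟨hk0, hk⟩ := hk
  norm_cast
  have hl := h.blockLength_pos hN j
  have hl' := h.blockLength_pos hN (j + 1)
  obtain ⟨s, hs⟩ := h.exists_parse hN hx j
  obtain ⟨s', hs'⟩ := h.exists_parse hN hx (j + 1)
  have ht2 := (hs' _).1 ht
  rw [blockLength_succ] at ht2
  set l := blockLength l₁ C j with hldef
  obtain ⟨hbN, hbP⟩ := hb (t / l + 1) (by omega) (by omega)
  have e1 := h.window_of_unpermuted ht hbN hbP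
  rw [← hldef] at e1
  have hdm := Nat.div_add_mod t l
  have hmod := Nat.mod_lt t hl
  -- the second word of `C j` is read entirely inside the window
  have e2 : window x (-t + ((t / l + 1) * l : ℕ) + k) l =
      window x (-t + ((t / l + 1) * l : ℕ)) l := by
    rw [window_eq_window_iff] at hk ⊢
    intro o ho
    have := hk (l - t % l + o) (by omega)
    convert this using 2
    · zify [hmod.le] at hdm ⊢; linear_combination hdm
    · zify [hmod.le] at hdm ⊢; linear_combination hdm
  have d1 : (l : ℤ) ∣ -t + ((t / l + 1) * l : ℕ) - s :=
    (hs _).1 (by rw [e1]; exact List.get_mem _ _)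
  have d2 : (l : ℤ) ∣ -t + ((t / l + 1) * l : ℕ) + k - s :=
    (hs _).1 (by rw [e2, e1]; exact List.get_mem _ _)
  obtain ⟨c, rfl⟩ : l ∣ k := by
    have := dvd_sub d2 d1
    rw [show (-t + ((t / l + 1) * l : ℕ) + k - s - (-t + ((t / l + 1) * l : ℕ) - s) : ℤ) = k by
      ring] at this
    exact_mod_cast this
  set N := (C j).length
  have hN0 : 0 < N := lt_of_lt_of_le (by norm_num) (hN j)
  set m := t / l + 1 + c with hm
  have hq : window x (-t + (m / N * (N * l) : ℕ)) (blockLength l₁ C (j + 1)) ∈ C (j + 1) := by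
    rw [hs', blockLength_succ]
    rw [add_sub_right_comm]
    refine dvd_add ht2 ?_
    push_cast
    exact Dvd.intro_left _ rfl
  have hr := Nat.mod_lt m hN0
  have hi := h.index_eq_of_unpermuted hq hbN hbP hr (by
    rw [← e1, ← e2, ← hldef]
    congr 1
    have : (m : ℤ) = t / l + 1 + c := by rw [hm]; push_cast; rfl
    have h2 : (N * (m / N) + m % N : ℤ) = m := by exact_mod_cast Nat.div_add_mod m N
    push_cast
    linear_combination (l : ℤ) * h2 + (l : ℤ) * this)
  have hdm2 := Nat.div_add_mod m N
  have hc : c = N * (m / N) := by omega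
  have hq0 : 1 ≤ m / N := by
    rcases Nat.eq_zero_or_pos (m / N) with h0 | h0
    · rw [h0] at hc
      simp [hc] at hk0
    · exact h0
  rw [blockLength_succ, hc, ← hldef, mul_comm l]
  exact Nat.mul_le_mul_right _ (Nat.le_mul_of_pos_right _ hq0)

lemma returnTime_eq_of_steady (h : IsConstruction l₁ C) (hN : ∀ j, 2 ≤ (C j).length)
    {x : ℤ → Bool} (hx : x ∈ subshift C) {j W n : ℕ} (hs : Steady l₁ C j W x)
    (hn : 2 * blockLength l₁ C j ≤ n) (hn' : n ≤ W * blockLength l₁ C j) :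
    returnTime n x = blockLength l₁ C (j + 1) := by
  refine le_antisymm (h.returnTime_le_of_steady hN hx hs hn')
    (h.le_returnTime_of_steady hN hx hs ?_ hn)
  have hl := h.blockLength_pos hN j
  rcases Nat.eq_zero_or_pos W with rfl | hW
  · omega
  · exact hW

end IsConstruction

/-! ### Growth of the construction -/

lemma succ_pow_four_le_factorial {s : ℕ} (hs : 8 ≤ s) : (s + 1) ^ 4 ≤ s.factorial := by
  induction s, hs using Nat.le_induction with
  | base => decide
  | succ s hs ih =>
    rw [Nat.factorial_succ]
    have h1 : (s + 1 + 1) ^ 4 ≤ (s + 1) * (s + 1) ^ 4 := by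
      have h2 : (s + 2) * 8 ≤ (s + 1) * 9 := by omega
      have h3 : ((s + 2) * 8) ^ 4 ≤ ((s + 1) * 9) ^ 4 := Nat.pow_le_pow_left h2 4
      have h4 : (9 : ℕ) ^ 4 * (s + 1) ^ 4 ≤ (8 ^ 4 * (s + 1)) * (s + 1) ^ 4 :=
        Nat.mul_le_mul_right _ (by omega)
      rw [mul_pow, mul_pow] at h3
      refine le_of_mul_le_mul_left (a := 8 ^ 4) ?_ (by norm_num)
      calc 8 ^ 4 * (s + 1 + 1) ^ 4 = (s + 2) ^ 4 * 8 ^ 4 := by ring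
        _ ≤ _ := h3
        _ = 9 ^ 4 * (s + 1) ^ 4 := by ring
        _ ≤ _ := h4
        _ = _ := by ring
    exact h1.trans (Nat.mul_le_mul_left _ ih)

lemma sq_le_factorial_sqrt {N : ℕ} (hN : 64 ≤ N) : N ^ 2 ≤ (Nat.sqrt N).factorial := by
  have hs : 8 ≤ Nat.sqrt N := Nat.le_sqrt.2 (by omega)
  have h1 : N ≤ (Nat.sqrt N + 1) ^ 2 := (Nat.lt_succ_sqrt' N).le
  calc N ^ 2 ≤ ((Nat.sqrt N + 1) ^ 2) ^ 2 := Nat.pow_le_pow_left h1 2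
    _ = (Nat.sqrt N + 1) ^ 4 := by ring
    _ ≤ _ := succ_pow_four_le_factorial hs

lemma log_factorial_sqrt_le {N : ℕ} (hN : 1 ≤ N) :
    Real.log (Nat.sqrt N).factorial ≤ √N * (Real.log N / 2) := by
  have hs : 1 ≤ Nat.sqrt N := Nat.le_sqrt.2 (by omega)
  have hs' : (Nat.sqrt N : ℝ) ≤ √N := Real.nat_sqrt_le_real_sqrt
  have h1 : ((Nat.sqrt N).factorial : ℝ) ≤ (Nat.sqrt N : ℝ) ^ Nat.sqrt N := by
    exact_mod_cast Nat.factorial_le_pow _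
  have hpos : (0 : ℝ) < Nat.sqrt N := by exact_mod_cast hs
  calc Real.log (Nat.sqrt N).factorial ≤ Real.log ((Nat.sqrt N : ℝ) ^ Nat.sqrt N) :=
        Real.log_le_log (by positivity) h1
    _ = Nat.sqrt N * Real.log (Nat.sqrt N) := Real.log_pow _ _
    _ ≤ √N * (Real.log N / 2) := by
        have h2 : Real.log (Nat.sqrt N) ≤ Real.log N / 2 := by
          rw [← Real.log_sqrt (by positivity)]
          exact Real.log_le_log hpos hs'
        have h3 : 0 ≤ Real.log (Nat.sqrt N) := Real.log_natCast_nonneg _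
        gcongr

lemma le_log_factorial_sqrt {N : ℕ} (hN : 1024 ≤ N) :
    √N * (Real.log N / 8) ≤ Real.log (Nat.sqrt N).factorial := by
  set s := Nat.sqrt N
  have hs : 32 ≤ s := Nat.le_sqrt.2 (by omega)
  have hsR : (32 : ℝ) ≤ s := by exact_mod_cast hs
  have hs' : √N ≤ s + 1 := Real.real_sqrt_le_nat_sqrt_succ
  have hs2 : √N / 2 ≤ s := by linarith
  have hNR : (1024 : ℝ) ≤ N := by exact_mod_cast hN
  have h1 : (s : ℝ) * (Real.log s - 1) ≤ Real.log s.factorial := by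
    have h := Real.pow_div_factorial_le_exp (x := s) (by positivity) s
    rw [div_le_iff₀ (by positivity)] at h
    have h' := Real.log_le_log (by positivity) h
    rw [Real.log_pow, Real.log_mul (by positivity) (by positivity), Real.log_exp] at h'
    linarith
  have h2 : Real.log N / 2 - Real.log 2 ≤ Real.log s := by
    rw [← Real.log_sqrt (by positivity), ← Real.log_div (by positivity) (by norm_num)]
    exact Real.log_le_log (by positivity) hs2
  have hl2 := Real.log_two_gt_d9
  have hl2' := Real.log_two_lt_d9
  -- This makes `log N / 4` at least `log 2 + 1`, the loss from rounding the root and from `s! ≥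
  -- (s/e)^s`.
  have h3 : 10 * Real.log 2 ≤ Real.log N := by
    have := Real.log_le_log (by norm_num) hNR
    rw [show (1024 : ℝ) = 2 ^ 10 by norm_num, Real.log_pow] at this
    exact_mod_cast this
  have h4 : Real.log N / 4 ≤ Real.log s - 1 := by linarith
  calc √N * (Real.log N / 8) = √N / 2 * (Real.log N / 4) := by ring
    _ ≤ s * (Real.log s - 1) := by
        have : 0 ≤ Real.log N / 4 := by linarith
        gcongr
    _ ≤ _ := h1

namespace IsConstruction

variable {l₁ : ℕ} {C : ℕ → List Word}

/-- The bound 100 on `l₁` gives `2 ^ 10 = 1024` initial words, enough for the factorial estimates at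
every level. -/
lemma le_length (h : IsConstruction l₁ C) (hl₁ : 100 ≤ l₁) (j : ℕ) : 1024 ≤ (C j).length := by
  induction j with
  | zero =>
    rw [h.card_eq]
    have : 10 ≤ Nat.sqrt l₁ := Nat.le_sqrt.2 hl₁
    calc 1024 = 2 ^ 10 := by norm_num
      _ ≤ _ := Nat.pow_le_pow_right (by norm_num) this
  | succ j ih =>
    rw [h.length_succ (by omega)]
    have := sq_le_factorial_sqrt (N := (C j).length) (by omega)
    nlinarith

lemma two_le_length (h : IsConstruction l₁ C) (hl₁ : 100 ≤ l₁) (j : ℕ) : 2 ≤ (C j).length :=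
  le_trans (by norm_num) (h.le_length hl₁ j)

lemma sq_length_le (h : IsConstruction l₁ C) (hl₁ : 100 ≤ l₁) (j : ℕ) :
    (C j).length ^ 2 ≤ (C (j + 1)).length := by
  rw [h.length_succ (h.two_le_length hl₁ j)]
  exact sq_le_factorial_sqrt (le_trans (by norm_num) (h.le_length hl₁ j))

lemma sixteen_pow_le_length (h : IsConstruction l₁ C) (hl₁ : 100 ≤ l₁) (j : ℕ) :
    16 ^ j ≤ (C j).length := by
  induction j with
  | zero => have := h.le_length hl₁ 0; omega
  | succ j ih =>
    have h1 := h.sq_length_le hl₁ j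
    have h2 := h.le_length hl₁ j
    rw [pow_succ]
    nlinarith

lemma two_pow_le_log_length (h : IsConstruction l₁ C) (hl₁ : 100 ≤ l₁) (j : ℕ) :
    (2 : ℝ) ^ (j + 1) ≤ Real.log (C j).length := by
  induction j with
  | zero =>
    have h2 : (1024 : ℝ) ≤ (C 0).length := by exact_mod_cast h.le_length hl₁ 0
    have := Real.log_le_log (by norm_num) h2
    rw [show (1024 : ℝ) = 2 ^ 10 by norm_num, Real.log_pow] at this
    have hl2 := Real.log_two_gt_d9
    push_cast at this
    norm_num
    linarith
  | succ j ih =>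
    have h1 : (((C j).length : ℝ)) ^ 2 ≤ (C (j + 1)).length := by
      exact_mod_cast h.sq_length_le hl₁ j
    have h2 : (1024 : ℝ) ≤ (C j).length := by exact_mod_cast h.le_length hl₁ j
    have := Real.log_le_log (by positivity) h1
    rw [Real.log_pow] at this
    push_cast at this
    rw [pow_succ]
    linarith

lemma log_blockLength_succ (h : IsConstruction l₁ C) (hl₁ : 100 ≤ l₁) (j : ℕ) :
    Real.log (blockLength l₁ C (j + 1)) =
      Real.log (C j).length + Real.log (blockLength l₁ C j) := by
  have h1 := h.two_le_length hl₁ j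
  have h2 := h.blockLength_pos (h.two_le_length hl₁) j
  rw [blockLength_succ, Nat.cast_mul, Real.log_mul (by positivity) (by positivity)]

lemma two_pow_le_log_blockLength (h : IsConstruction l₁ C) (hl₁ : 100 ≤ l₁) (j : ℕ) :
    (2 : ℝ) ^ j ≤ Real.log (blockLength l₁ C j) := by
  cases j with
  | zero =>
    have h2 : (4 : ℝ) ≤ l₁ := by exact_mod_cast (show 4 ≤ l₁ by omega)
    have := Real.log_le_log (by norm_num) h2
    rw [show (4 : ℝ) = 2 ^ 2 by norm_num, Real.log_pow] at this
    have hl2 := Real.log_two_gt_d9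
    push_cast at this
    simp only [pow_zero, blockLength]
    linarith
  | succ j =>
    rw [h.log_blockLength_succ hl₁]
    have := Real.log_natCast_nonneg (blockLength l₁ C j)
    linarith [h.two_pow_le_log_length hl₁ j]

lemma sqrt_blockLength_succ (j : ℕ) :
    √(blockLength l₁ C (j + 1) : ℝ) = √((C j).length : ℝ) * √(blockLength l₁ C j : ℝ) := by
  rw [blockLength_succ, Nat.cast_mul, Real.sqrt_mul (by positivity)]

/-- `log N_j` and `√l_j` both acquire the factor `√N_j` at each step, and the former also a factor
at most 1/2. The base case needs `l₁` to be a square. -/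
lemma log_length_le (h : IsConstruction l₁ C) (hl₁ : 100 ≤ l₁) (hsq : IsSquare l₁) (j : ℕ) :
    Real.log (C j).length ≤ √(blockLength l₁ C j : ℝ) * (1 / 2) ^ j := by
  induction j with
  | zero =>
    obtain ⟨m, rfl⟩ := hsq
    have hl2 := Real.log_two_lt_d9
    rw [h.card_eq, Nat.sqrt_eq]
    simp only [blockLength]
    push_cast
    rw [Real.log_pow, Real.sqrt_mul_self (by positivity), pow_zero]
    gcongr
    linarith
  | succ j ih =>
    have hN := h.le_length hl₁ j
    rw [h.length_succ (by omega), sqrt_blockLength_succ]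
    refine (log_factorial_sqrt_le (by omega)).trans ?_
    rw [mul_assoc]
    refine mul_le_mul_of_nonneg_left ?_ (by positivity)
    rw [pow_succ]
    linarith

lemma le_log_length (h : IsConstruction l₁ C) (hl₁ : 100 ≤ l₁) (hsq : IsSquare l₁) (j : ℕ) :
    √(blockLength l₁ C j : ℝ) / 2 * (1 / 8) ^ j ≤ Real.log (C j).length := by
  induction j with
  | zero =>
    obtain ⟨m, rfl⟩ := hsq
    have hl2 := Real.log_two_gt_d9
    rw [h.card_eq, Nat.sqrt_eq]
    simp only [blockLength]
    push_cast
    rw [Real.log_pow, Real.sqrt_mul_self (by positivity), pow_zero, mul_one, div_eq_mul_one_div]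
    gcongr
    linarith
  | succ j ih =>
    have hN := h.le_length hl₁ j
    rw [h.length_succ (by omega), sqrt_blockLength_succ]
    refine le_trans ?_ (le_log_factorial_sqrt (by omega))
    rw [mul_div_assoc, mul_assoc]
    refine mul_le_mul_of_nonneg_left ?_ (by positivity)
    rw [pow_succ]
    linarith

lemma log_le_two_mul_sqrt (x : ℝ) (hx : 0 < x) : Real.log x ≤ 2 * √x := by
  have := Real.log_le_sub_one_of_pos (Real.sqrt_pos.2 hx)
  rw [Real.log_sqrt hx.le] at this
  linarith

lemma log_blockLength_succ_le (h : IsConstruction l₁ C) (hl₁ : 100 ≤ l₁) (hsq : IsSquare l₁)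
    (j : ℕ) : Real.log (blockLength l₁ C (j + 1)) ≤ 3 * √(blockLength l₁ C j : ℝ) := by
  have h1 := h.log_length_le hl₁ hsq j
  have h2 := log_le_two_mul_sqrt (blockLength l₁ C j)
    (by exact_mod_cast h.blockLength_pos (h.two_le_length hl₁) j)
  have h3 : √(blockLength l₁ C j : ℝ) * (1 / 2) ^ j ≤ √(blockLength l₁ C j : ℝ) * 1 := by
    gcongr
    exact pow_le_one₀ (by norm_num) (by norm_num)
  rw [h.log_blockLength_succ hl₁]
  linarith

lemma tendsto_blockLength (h : IsConstruction l₁ C) (hl₁ : 100 ≤ l₁) :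
    Tendsto (fun j => (blockLength l₁ C j : ℝ)) atTop atTop := by
  refine tendsto_atTop_mono (fun j => ?_) (tendsto_pow_atTop_atTop_of_one_lt one_lt_two)
  have hpos : (0 : ℝ) < blockLength l₁ C j := by
    exact_mod_cast h.blockLength_pos (h.two_le_length hl₁) j
  exact (h.two_pow_le_log_blockLength hl₁ j).trans (Real.log_le_self hpos.le)

/-- The gain `2^{-j}` makes the quotient vanish even at the exponent 1/2 itself, so that limits also
exist at `β = τ`. -/
lemma tendsto_log_div_sqrt (h : IsConstruction l₁ C) (hl₁ : 100 ≤ l₁) (hsq : IsSquare l₁) :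
    Tendsto (fun j => Real.log (blockLength l₁ C (j + 1)) / √(blockLength l₁ C j : ℝ))
      atTop (𝓝 0) := by
  have hpos : ∀ j, (0 : ℝ) < blockLength l₁ C j := fun j => by
    exact_mod_cast h.blockLength_pos (h.two_le_length hl₁) j
  have h1 : Tendsto (fun j => Real.log (blockLength l₁ C j) / √(blockLength l₁ C j : ℝ))
      atTop (𝓝 0) := by
    have := (isLittleO_log_rpow_atTop (r := 1 / 2) (by norm_num)).tendsto_div_nhds_zero
    simp only [← Real.sqrt_eq_rpow] at this
    exact this.comp (h.tendsto_blockLength hl₁)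
  have h2 : Tendsto (fun j => Real.log (C j).length / √(blockLength l₁ C j : ℝ))
      atTop (𝓝 0) := by
    refine squeeze_zero (fun j => ?_) (fun j => ?_)
      (tendsto_pow_atTop_nhds_zero_of_lt_one (r := (1 / 2 : ℝ)) (by norm_num) (by norm_num))
    · exact div_nonneg (Real.log_natCast_nonneg _) (by positivity)
    · rw [div_le_iff₀ (Real.sqrt_pos.2 (hpos j)), mul_comm]
      exact h.log_length_le hl₁ hsq j
  have := h2.add h1
  simp only [add_zero, ← add_div] at this
  simpa only [h.log_blockLength_succ hl₁] using this

lemma tendsto_rpow_div_pow (h : IsConstruction l₁ C) (hl₁ : 100 ≤ l₁) {δ : ℝ} (hδ : 0 < δ) :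
    Tendsto (fun j => (blockLength l₁ C j : ℝ) ^ δ / 8 ^ j) atTop atTop := by
  have h1 : Tendsto (fun j : ℕ => δ ^ 4 / 24 * (2 : ℝ) ^ j) atTop atTop :=
    (tendsto_pow_atTop_atTop_of_one_lt one_lt_two).const_mul_atTop (by positivity)
  refine tendsto_atTop_mono (fun j => ?_) h1
  have hpos : (0 : ℝ) < blockLength l₁ C j := by
    exact_mod_cast h.blockLength_pos (h.two_le_length hl₁) j
  rw [le_div_iff₀ (by positivity), Real.rpow_def_of_pos hpos]
  -- The fourth-order term of the exponential is the first to beat `8^j`, since `2^{4j} = 2^j ·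
  -- 8^j`.
  have h2 := Real.pow_div_factorial_le_exp (x := δ * 2 ^ j) (by positivity) 4
  have h3 : δ * 2 ^ j ≤ Real.log (blockLength l₁ C j) * δ := by
    rw [mul_comm]
    exact mul_le_mul_of_nonneg_right (h.two_pow_le_log_blockLength hl₁ j) hδ.le
  refine le_trans (le_of_eq ?_) (h2.trans (Real.exp_le_exp.2 h3))
  rw [show (8 : ℝ) = 2 ^ 3 by norm_num, ← pow_mul, show Nat.factorial 4 = 24 by rfl]
  push_cast
  ring

lemma tendsto_log_div_rpow (h : IsConstruction l₁ C) (hl₁ : 100 ≤ l₁) (hsq : IsSquare l₁) {γ : ℝ}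
    (hγ : γ < 1 / 2) :
    Tendsto (fun j => Real.log (blockLength l₁ C (j + 1)) / (blockLength l₁ C j : ℝ) ^ γ)
      atTop atTop := by
  have h1 := (h.tendsto_rpow_div_pow hl₁ (sub_pos.2 hγ)).const_mul_atTop
    (show (0 : ℝ) < 1 / 2 by norm_num)
  refine tendsto_atTop_mono (fun j => ?_) h1
  have hpos : (0 : ℝ) < blockLength l₁ C j := by
    exact_mod_cast h.blockLength_pos (h.two_le_length hl₁) j
  have h2 := h.le_log_length hl₁ hsq j
  have h3 := Real.log_natCast_nonneg (blockLength l₁ C j)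
  rw [le_div_iff₀ (by positivity), h.log_blockLength_succ hl₁, Real.rpow_sub hpos,
    ← Real.sqrt_eq_rpow]
  refine le_trans (le_of_eq ?_) (h2.trans (le_add_of_nonneg_right h3))
  have : (blockLength l₁ C j : ℝ) ^ γ ≠ 0 := by positivity
  rw [div_pow, one_pow]
  field_simp

/-- The fourth root of `N_j` thus exceeds `l_j ^ j`, which leaves room for window lengths with
unbounded exponents, as `τ = 0` requires. -/
lemma eventually_pow_le_length (h : IsConstruction l₁ C) (hl₁ : 100 ≤ l₁) (hsq : IsSquare l₁) :
    ∀ᶠ j in atTop, blockLength l₁ C j ^ (4 * j) ≤ (C j).length := by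
  -- With `w = l^{1/4}`, the logarithm to be bounded is at most `256 w`, and the available bound is
  -- `w² / (2 · 8^j)`; hence 512.
  filter_upwards [(h.tendsto_rpow_div_pow hl₁ (δ := 1 / 4) (by norm_num)).eventually_ge_atTop 512]
    with j hj
  have hpos : (0 : ℝ) < blockLength l₁ C j := by
    exact_mod_cast h.blockLength_pos (h.two_le_length hl₁) j
  have hN : (0 : ℝ) < (C j).length := by
    exact_mod_cast lt_of_lt_of_le (by norm_num) (h.two_le_length hl₁ j)
  have hgoal : Real.log ((blockLength l₁ C j : ℝ) ^ (4 * j)) ≤ Real.log (C j).length := by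
    refine le_trans ?_ (h.le_log_length hl₁ hsq j)
    have h2 := h.two_pow_le_log_blockLength hl₁ j
    rw [le_div_iff₀ (by positivity)] at hj
    rw [Real.log_pow]
    have h3 := Real.log_le_rpow_div hpos.le (show (0 : ℝ) < 1 / 8 by norm_num)
    have h4 : (j : ℝ) ≤ 2 ^ j := by exact_mod_cast Nat.lt_two_pow_self.le
    have e1 : (blockLength l₁ C j : ℝ) ^ (1 / 4 : ℝ) =
        ((blockLength l₁ C j : ℝ) ^ (1 / 8 : ℝ)) ^ 2 := by
      rw [← Real.rpow_natCast, ← Real.rpow_mul hpos.le]; norm_num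
    have e2 : √(blockLength l₁ C j : ℝ) = ((blockLength l₁ C j : ℝ) ^ (1 / 4 : ℝ)) ^ 2 := by
      rw [← Real.rpow_natCast, ← Real.rpow_mul hpos.le, Real.sqrt_eq_rpow]; norm_num
    rw [e2]
    set z := (blockLength l₁ C j : ℝ) ^ (1 / 8 : ℝ)
    set w := (blockLength l₁ C j : ℝ) ^ (1 / 4 : ℝ)
    have hw : 0 ≤ w := by positivity
    have h5 : Real.log (blockLength l₁ C j) ≤ 8 * z := by linarith
    have hl0 : 0 ≤ Real.log (blockLength l₁ C j) := Real.log_natCast_nonneg _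
    calc ((4 * j : ℕ) : ℝ) * Real.log (blockLength l₁ C j)
        ≤ 4 * (8 * z) * (8 * z) := by
          push_cast
          gcongr
          linarith
      _ = 256 * w := by rw [e1]; ring
      _ = (512 * 8 ^ j) * w / 2 * (1 / 8) ^ j := by rw [div_pow, one_pow]; field_simp; ring
      _ ≤ w * w / 2 * (1 / 8) ^ j := by gcongr
      _ = w ^ 2 / 2 * (1 / 8) ^ j := by ring
  have := (Real.log_le_log_iff (by positivity) hN).1 hgoal
  exact_mod_cast this

end IsConstruction

/-! ### Almost every point is eventually in steady position -/

lemma measurableSet_window (P : Word → Prop) (i : ℤ) (n : ℕ) :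
    MeasurableSet {x : ℤ → Bool | P (window x i n)} := by
  have h1 : Measurable fun (x : ℤ → Bool) (k : Fin n) => x (i + (k : ℕ)) := by fun_prop
  exact h1 (t := {g : Fin n → Bool | P (List.ofFn g)}) (Set.toFinite _).measurableSet

lemma measure_window_add {μ : Measure (ℤ → Bool)} (hμ : MeasurePreserving shift μ μ)
    (P : Word → Prop) (i : ℤ) (p n : ℕ) :
    μ {x | P (window x (i + p) n)} = μ {x | P (window x i n)} := by
  rw [← (hμ.iterate p).measure_preimage (measurableSet_window P i n).nullMeasurableSet]
  congr 1
  ext x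
  simp only [Set.mem_ofPred_eq, Set.mem_preimage, window_shift_iterate]

/-- The offsets in a word of the next level from whose block on one of the `W + 1` consecutive
block positions is permuted or does not exist. -/
noncomputable def unsteadyOffsets (N l W : ℕ) : Finset ℕ := by
  classical
  exact (Finset.range (N * l)).filter fun t =>
    ∃ b, t / l ≤ b ∧ b ≤ t / l + W ∧ (b < N → b + 1 ∈ permutedPositions N)

lemma card_unsteadyOffsets_le {N l : ℕ} (hl : 0 < l) (W : ℕ) :
    (unsteadyOffsets N l W).card ≤ (Nat.sqrt N + 2) * (W + 1) * l := by
  classical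
  -- Zero-based: `N` stands for running past the end of the word, `1` for position 2, the others for
  -- squares.
  set P : Finset ℕ := insert N (insert 1 ((Finset.range (Nat.sqrt N)).image
    fun i => (i + 1) ^ 2 - 1)) with hP
  have hPc : P.card ≤ Nat.sqrt N + 2 := by
    refine (Finset.card_insert_le _ _).trans (Nat.succ_le_succ ?_)
    refine (Finset.card_insert_le _ _).trans (Nat.succ_le_succ ?_)
    exact Finset.card_image_le.trans (by simp)
  have hsub : unsteadyOffsets N l W ⊆
      ((P ×ˢ Finset.range (W + 1)) ×ˢ Finset.range l).image
        fun z => (z.1.1 - z.1.2) * l + z.2 := by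
    intro t ht
    simp only [unsteadyOffsets, Finset.mem_filter, Finset.mem_range] at ht
    obtain ⟨htN, b, hb, hbW, hbP⟩ := ht
    have htl : t / l < N := Nat.div_lt_of_lt_mul (by rwa [mul_comm])
    obtain ⟨p, hp, hp1, hp2⟩ : ∃ p ∈ P, t / l ≤ p ∧ p ≤ t / l + W := by
      by_cases hbN : b < N
      · refine ⟨b, ?_, hb, hbW⟩
        rcases hbP hbN with h | ⟨i, hi, hi', h⟩
        · obtain rfl : b = 1 := by omega
          simp [hP]
        · simp only [hP, Finset.mem_insert, Finset.mem_image, Finset.mem_range]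
          refine Or.inr (Or.inr ⟨i - 1, by omega, ?_⟩)
          have : i - 1 + 1 = i := by omega
          rw [this, ← h]
          rfl
      · exact ⟨N, by simp [hP], by omega, by omega⟩
    refine Finset.mem_image.2 ⟨((p, p - t / l), t % l), ?_, ?_⟩
    · simp only [Finset.mem_product, Finset.mem_range]
      exact ⟨⟨hp, Nat.lt_succ_of_le (Nat.sub_le_iff_le_add'.2 hp2)⟩, Nat.mod_lt _ hl⟩
    · have : p - (p - t / l) = t / l := Nat.sub_sub_self hp1
      simp only [this]
      exact Nat.div_add_mod' t l
  refine (Finset.card_le_card hsub).trans (Finset.card_image_le.trans ?_)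
  simp only [Finset.card_product, Finset.card_range]
  gcongr

namespace IsConstruction

variable {l₁ : ℕ} {C : ℕ → List Word} {μ : Measure (ℤ → Bool)}

lemma exists_offset (h : IsConstruction l₁ C) (hN : ∀ j, 2 ≤ (C j).length) {x : ℤ → Bool}
    (hx : x ∈ subshift C) (j : ℕ) :
    ∃ t < blockLength l₁ C j, window x (-t) (blockLength l₁ C j) ∈ C j := by
  obtain ⟨s, hs⟩ := h.exists_parse hN hx j
  have hl := h.blockLength_pos hN j
  set l := blockLength l₁ C j
  have h0 := Int.emod_nonneg (-s) (show (l : ℤ) ≠ 0 by exact_mod_cast hl.ne')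
  have h1 := Int.emod_lt_of_pos (-s) (show (0 : ℤ) < l by exact_mod_cast hl)
  have h2 : (((-s % l).toNat : ℕ) : ℤ) = -s % l := Int.toNat_of_nonneg h0
  refine ⟨(-s % l).toNat, by omega, ?_⟩
  rw [hs, h2, show -(-s % l) - s = -s - (-s % l) by ring]
  exact Int.dvd_self_sub_emod

/-- By recognizability the `l_j` possible offsets are almost surely exclusive, and by invariance
they are equally likely. -/
lemma measure_offset_le (h : IsConstruction l₁ C) (hN : ∀ j, 2 ≤ (C j).length)
    [IsProbabilityMeasure μ] (hX : ∀ᵐ x ∂μ, x ∈ subshift C) (hμ : MeasurePreserving shift μ μ)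
    (j t : ℕ) :
    μ {x | window x (-t) (blockLength l₁ C j) ∈ C j} ≤ (blockLength l₁ C j : ENNReal)⁻¹ := by
  set l := blockLength l₁ C j with hl
  set E : ℕ → Set (ℤ → Bool) := fun p => {x | window x (-p) l ∈ C j} with hE
  have hm : ∀ p, MeasurableSet (E p) := fun p => measurableSet_window (· ∈ C j) _ _
  have heq : ∀ p, μ (E p) = μ (E t) := by
    have : ∀ p, μ (E p) = μ {x | window x 0 l ∈ C j} := by
      intro p
      have := measure_window_add hμ (· ∈ C j) (-p) p l
      rw [neg_add_cancel] at this
      exact this.symm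
    intro p
    rw [this, this]
  have hdisj : (Finset.range l : Set ℕ).Pairwise (Function.onFun (AEDisjoint μ) E) := by
    intro p hp q hq hpq
    refine measure_mono_null (t := {x | ¬ x ∈ subshift C}) ?_ hX
    rintro x ⟨h1, h2⟩ hx
    obtain ⟨s, hs⟩ := h.exists_parse hN hx j
    have := dvd_sub ((hs _).1 h1) ((hs _).1 h2)
    rw [show (-p - s - (-q - s) : ℤ) = q - p by ring] at this
    have hmod : p ≡ q [MOD l] := Nat.modEq_iff_dvd.2 this
    simp only [Finset.coe_range, Set.mem_Iio] at hp hq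
    exact hpq (hmod.eq_of_lt_of_lt hp hq)
  have hsum := measure_biUnion_finset₀ hdisj fun p _ => (hm p).nullMeasurableSet
  simp only [heq, Finset.sum_const, Finset.card_range, nsmul_eq_mul] at hsum
  rw [ENNReal.le_inv_iff_mul_le, mul_comm, ← hsum]
  exact prob_le_one

lemma measure_not_steady_le (h : IsConstruction l₁ C) (hN : ∀ j, 2 ≤ (C j).length)
    [IsProbabilityMeasure μ] (hX : ∀ᵐ x ∂μ, x ∈ subshift C) (hμ : MeasurePreserving shift μ μ)
    (j W : ℕ) :
    μ {x | x ∈ subshift C ∧ ¬ Steady l₁ C j W x} ≤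
      (unsteadyOffsets (C j).length (blockLength l₁ C j) W).card *
        (blockLength l₁ C (j + 1) : ENNReal)⁻¹ := by
  set B := unsteadyOffsets (C j).length (blockLength l₁ C j) W with hB
  have hsub : {x | x ∈ subshift C ∧ ¬ Steady l₁ C j W x} ⊆
      ⋃ t ∈ B, {x | window x (-t) (blockLength l₁ C (j + 1)) ∈ C (j + 1)} := by
    rintro x ⟨hx, hns⟩
    obtain ⟨t, ht, hw⟩ := h.exists_offset hN hx (j + 1)
    simp only [Set.mem_iUnion]
    refine ⟨t, ?_, hw⟩
    simp only [hB, unsteadyOffsets, Finset.mem_filter, Finset.mem_range]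
    refine ⟨ht, ?_⟩
    by_contra hc
    push Not at hc
    exact hns ⟨t, hw, fun b hb hb' => hc b hb hb'⟩
  refine (measure_mono hsub).trans ((measure_biUnion_finset_le _ _).trans ?_)
  refine (Finset.sum_le_sum fun t _ => h.measure_offset_le hN hX hμ (j + 1) t).trans ?_
  rw [Finset.sum_const, nsmul_eq_mul]

/-- With `W ≈ N^{1/4}` the bad offsets have proportion of order `√N · W / N`, that is `N^{-1/4}`,
which is summable because `N_j ≥ 16^j`. -/
lemma ae_eventually_steady (h : IsConstruction l₁ C) (hl₁ : 100 ≤ l₁)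
    [IsProbabilityMeasure μ] (hX : ∀ᵐ x ∂μ, x ∈ subshift C) (hμ : MeasurePreserving shift μ μ) :
    ∀ᵐ x ∂μ, ∀ᶠ j in atTop, Steady l₁ C j (Nat.sqrt (Nat.sqrt (C j).length)) x := by
  have hN := h.two_le_length hl₁
  have hbound : ∀ j, μ {x | x ∈ subshift C ∧
      ¬ Steady l₁ C j (Nat.sqrt (Nat.sqrt (C j).length)) x} ≤ 4 * (2⁻¹ : ENNReal) ^ j := by
    intro j
    refine (h.measure_not_steady_le hN hX hμ j _).trans ?_
    have hl := h.blockLength_pos hN j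
    have hl' := h.blockLength_pos hN (j + 1)
    set N := (C j).length
    set l := blockLength l₁ C j
    set s := Nat.sqrt N
    set W := Nat.sqrt s
    have hs2 : s * s ≤ N := Nat.sqrt_le N
    have hW2 : W * W ≤ s := Nat.sqrt_le s
    have h16 : 16 ^ j ≤ N := h.sixteen_pow_le_length hl₁ j
    have h4 : 4 ^ j ≤ s := Nat.le_sqrt.2 (by rwa [← mul_pow])
    have h2 : 2 ^ j ≤ W := Nat.le_sqrt.2 (by rwa [← mul_pow])
    have hs : 2 ≤ s := Nat.le_sqrt.2 (le_trans (by norm_num) (h.le_length hl₁ j))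
    have hW : 1 ≤ W := Nat.le_sqrt.2 (by omega)
    have hcount : (unsteadyOffsets N l W).card * 2 ^ j ≤ 4 * blockLength l₁ C (j + 1) := by
      calc (unsteadyOffsets N l W).card * 2 ^ j ≤ (s + 2) * (W + 1) * l * W := by
            gcongr
            exact card_unsteadyOffsets_le hl W
        _ ≤ (2 * s) * (2 * W) * l * W := by gcongr <;> omega
        _ = 4 * (s * (W * W) * l) := by ring
        _ ≤ 4 * (s * s * l) := by gcongr
        _ ≤ 4 * (N * l) := by gcongr
    rw [← div_eq_mul_inv, ← ENNReal.inv_pow, ← div_eq_mul_inv]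
    refine ENNReal.div_le_of_le_mul ?_
    rw [ENNReal.div_eq_inv_mul, mul_assoc, ← ENNReal.div_eq_inv_mul,
      ENNReal.le_div_iff_mul_le (by simp) (by simp)]
    exact_mod_cast hcount
  have hsum : ∑' j, μ {x | x ∈ subshift C ∧
      ¬ Steady l₁ C j (Nat.sqrt (Nat.sqrt (C j).length)) x} ≠ ⊤ := by
    refine ne_top_of_le_ne_top ?_ (ENNReal.tsum_le_tsum hbound)
    rw [ENNReal.tsum_mul_left, ENNReal.tsum_geometric, ENNReal.one_sub_inv_two, inv_inv]
    exact ENNReal.mul_ne_top (by simp) (by simp)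
  filter_upwards [ae_eventually_notMem hsum, hX] with x hx hxX
  filter_upwards [hx] with j hj
  by_contra hc
  exact hj ⟨hxX, hc⟩

end IsConstruction

/-! ### Return times and complexity -/

/-- The preimages of the set under the first `K + 1` iterates of the shift are disjoint, since two
visits to `w` would be at most `K` apart, and they have equal measure. -/
lemma measure_no_return_le {μ : Measure (ℤ → Bool)} [IsProbabilityMeasure μ]
    (hμ : MeasurePreserving shift μ μ) (w : Word) (n K : ℕ) :
    μ {x | window x 0 n = w ∧ ∀ k ∈ Finset.Icc 1 K, window x (k : ℤ) n ≠ w} ≤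
      ((K + 1 : ℕ) : ENNReal)⁻¹ := by
  set B := {x : ℤ → Bool | window x 0 n = w ∧ ∀ k ∈ Finset.Icc 1 K, window x (k : ℤ) n ≠ w}
    with hB
  have hBm : MeasurableSet B := by
    have : B = {x | window x 0 n = w} ∩
        ⋂ k ∈ Finset.Icc 1 K, {x | window x (k : ℤ) n ≠ w} := by
      ext x
      simp [hB]
    rw [this]
    refine (measurableSet_window (· = w) 0 n).inter ?_
    exact Finset.measurableSet_biInter _ fun k _ => measurableSet_window (· ≠ w) _ _
  have hdisj : (Finset.range (K + 1) : Set ℕ).PairwiseDisjoint fun i => shift^[i] ⁻¹' B := by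
    have key : ∀ p q : ℕ, p < q → q < K + 1 →
        Disjoint (shift^[p] ⁻¹' B) (shift^[q] ⁻¹' B) := by
      intro p q hpq hq
      rw [Set.disjoint_left]
      rintro x ⟨-, h1⟩ ⟨h2, -⟩
      refine h1 (q - p) (Finset.mem_Icc.2 (by omega)) ?_
      rw [window_shift_iterate] at h2 ⊢
      rw [← h2]
      congr 1
      omega
    intro p hp q hq hpq
    simp only [Finset.coe_range, Set.mem_Iio] at hp hq
    rcases lt_or_gt_of_ne hpq with h | h
    · exact key p q h hq
    · exact (key q p h hp).symm
  have hsum := measure_biUnion_finset (μ := μ) hdisj fun i _ =>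
    (hμ.iterate i).measurable hBm
  simp only [fun i => (hμ.iterate i).measure_preimage hBm.nullMeasurableSet, Finset.sum_const,
    Finset.card_range, nsmul_eq_mul] at hsum
  rw [ENNReal.le_inv_iff_mul_le, mul_comm, ← hsum]
  exact prob_le_one

lemma measure_lt_returnTime_le {μ : Measure (ℤ → Bool)} [IsProbabilityMeasure μ]
    (hμ : MeasurePreserving shift μ μ) (L : Finset Word) (n K : ℕ) :
    μ {x | window x 0 n ∈ L ∧ (K : ℕ∞) < returnTime n x} ≤
      L.card * ((K + 1 : ℕ) : ENNReal)⁻¹ := by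
  have hsub : {x | window x 0 n ∈ L ∧ (K : ℕ∞) < returnTime n x} ⊆
      ⋃ w ∈ L, {x | window x 0 n = w ∧ ∀ k ∈ Finset.Icc 1 K, window x (k : ℤ) n ≠ w} := by
    rintro x ⟨hx, hK⟩
    simp only [Set.mem_iUnion]
    refine ⟨_, hx, rfl, fun k hk hw => ?_⟩
    rw [Finset.mem_Icc] at hk
    have : returnTime n x ≤ k := iInf₂_le k ⟨hk.1, hw⟩
    exact absurd (hK.trans_le this) (by simpa using hk.2)
  refine (measure_mono hsub).trans ((measure_biUnion_finset_le _ _).trans ?_)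
  refine (Finset.sum_le_sum fun w _ => measure_no_return_le hμ w n K).trans ?_
  rw [Finset.sum_const, nsmul_eq_mul]

/-! ### Squares in short intervals and the number of windows. -/

lemma card_le_sqrt_of_sq_le (T : Finset ℕ) (m : ℕ) (hT : ∀ q ∈ T, ∀ q' ∈ T, q' ^ 2 ≤ q ^ 2 + m) :
    T.card ≤ Nat.sqrt m + 1 := by
  rcases T.eq_empty_or_nonempty with rfl | hne
  · simp
  · have hsub : T ⊆ Finset.Icc (T.min' hne) (T.min' hne + Nat.sqrt m) := by
      intro q hq
      have h1 := T.min'_le q hq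
      have h2 := hT _ (T.min'_mem hne) q hq
      obtain ⟨d, hd⟩ := Nat.exists_eq_add_of_le h1
      have h3 : d ≤ Nat.sqrt m := Nat.le_sqrt'.2 (by rw [hd] at h2; nlinarith)
      rw [Finset.mem_Icc]
      omega
    refine (Finset.card_le_card hsub).trans ?_
    rw [Nat.card_Icc]
    omega

/-- The block indices between `i` and `i + m`, in a concatenation of two words of the next level,
that are permuted. -/
noncomputable def freeBlocks (N i m : ℕ) : Finset ℕ := by
  classical
  exact (Finset.Icc i (i + m)).filter fun b => b < 2 * N ∧ b % N + 1 ∈ permutedPositions N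

lemma card_freeBlocks_le (N i m : ℕ) : (freeBlocks N i m).card ≤ 2 * Nat.sqrt m + 4 := by
  classical
  set T : ℕ → Finset ℕ := fun c => (Finset.range (i + m + 2)).filter
    fun q => i + 1 ≤ c + q ^ 2 ∧ c + q ^ 2 ≤ i + m + 1 with hT
  have hTc : ∀ c, (T c).card ≤ Nat.sqrt m + 1 := by
    intro c
    refine card_le_sqrt_of_sq_le _ _ fun q hq q' hq' => ?_
    simp only [hT, Finset.mem_filter] at hq hq'
    omega
  set F : ℕ → Finset ℕ := fun c => insert (c + 1) ((T c).image fun q => c + q ^ 2 - 1) with hF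
  have hFc : ∀ c, (F c).card ≤ Nat.sqrt m + 2 := fun c =>
    (Finset.card_insert_le _ _).trans (Nat.succ_le_succ (Finset.card_image_le.trans (hTc c)))
  have hmem : ∀ c p, p + 1 ∈ permutedPositions N → i ≤ c + p → c + p ≤ i + m → c + p ∈ F c := by
    rintro c p (hp | ⟨q, hq, -, hp⟩) h1 h2
    · obtain rfl : p = 1 := by omega
      simp [hF]
    · refine Finset.mem_insert_of_mem (Finset.mem_image.2 ⟨q, ?_, by omega⟩)
      have : q ≤ q ^ 2 := Nat.le_self_pow (by norm_num) q
      simp only [hT, Finset.mem_filter, Finset.mem_range]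
      omega
  have hsub : freeBlocks N i m ⊆ F 0 ∪ F N := by
    intro b hb
    simp only [freeBlocks, Finset.mem_filter, Finset.mem_Icc] at hb
    obtain ⟨⟨h1, h2⟩, h3, h4⟩ := hb
    rw [Finset.mem_union]
    by_cases hbN : b < N
    · left
      rw [Nat.mod_eq_of_lt hbN] at h4
      have := hmem 0 b h4 (by omega) (by omega)
      rwa [zero_add] at this
    · right
      obtain ⟨p, rfl⟩ := Nat.exists_eq_add_of_le (not_lt.1 hbN)
      rw [Nat.add_mod_left, Nat.mod_eq_of_lt (by omega)] at h4
      exact hmem N p h4 h1 h2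
  refine (Finset.card_le_card hsub).trans ((Finset.card_union_le _ _).trans ?_)
  have := hFc 0
  have := hFc N
  omega

namespace IsConstruction

variable {l₁ : ℕ} {C : ℕ → List Word} {μ : Measure (ℤ → Bool)}

/-- The window lies in two consecutive words of level `j + 1`. It is determined by the offset of the
origin and by the contents of the permuted blocks it can meet. -/
lemma exists_window_cover (h : IsConstruction l₁ C) (hN : ∀ j, 2 ≤ (C j).length) {j n : ℕ}
    (hn : n ≤ blockLength l₁ C (j + 1)) :
    ∃ L : Finset Word, L.card ≤ blockLength l₁ C (j + 1) *
        (C j).length ^ (2 * Nat.sqrt (n / blockLength l₁ C j + 1) + 4) ∧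
      ∀ x ∈ subshift C, window x 0 n ∈ L := by
  classical
  have hl := h.blockLength_pos hN j
  have hNj : 0 < (C j).length := lt_of_lt_of_le (by norm_num) (hN j)
  set l' := blockLength l₁ C (j + 1) with hl'def
  have hl' : l' = (C j).length * blockLength l₁ C j := blockLength_succ _ _ _
  set l := blockLength l₁ C j with hldef
  set N := (C j).length with hNdef
  set m := n / l + 1 with hm
  set Q : ℕ → Finset ℕ := fun t => freeBlocks N (t / l) m with hQ
  -- An unpermuted block is read off from its index modulo `N`. The default letter never occurs, as
  -- remainders modulo `l` stay inside a word of length `l`.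
  let dec : (Σ t : Fin l', (Q t → Fin N)) → Word := fun z =>
    List.ofFn fun k : Fin n =>
      ((C j).get (if hb : (z.1 + k : ℕ) / l ∈ Q z.1 then z.2 ⟨_, hb⟩ else
        ⟨(z.1 + k : ℕ) / l % N, Nat.mod_lt _ hNj⟩)).getD ((z.1 + k : ℕ) % l) false
  refine ⟨Finset.univ.image dec, ?_, fun x hx => ?_⟩
  · refine Finset.card_image_le.trans ?_
    rw [Finset.card_univ, Fintype.card_sigma]
    refine (Finset.sum_le_card_nsmul _ _ (N ^ (2 * Nat.sqrt m + 4)) fun t _ => ?_).trans ?_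
    · rw [Fintype.card_fun, Fintype.card_fin, Fintype.card_coe]
      exact Nat.pow_le_pow_right hNj (card_freeBlocks_le _ _ _)
    · simp
  · obtain ⟨t, ht, hw⟩ := h.exists_offset hN hx (j + 1)
    rw [← hl'def] at ht hw
    have hw' : window x (-t + l') l' ∈ C (j + 1) := by
      obtain ⟨s, hs⟩ := h.exists_parse hN hx (j + 1)
      rw [hs] at hw ⊢
      rw [add_sub_right_comm]
      exact dvd_add_self_right.2 hw
    -- every block in the two words of the next level is some word of `C j`
    have hblock : ∀ b : ℕ, ∃ i : Fin N, b < 2 * N →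
        window x (-t + (b * l : ℕ)) l = (C j).get i ∧
          (b % N + 1 ∉ permutedPositions N → (i : ℕ) = b % N) := by
      intro b
      by_cases hbN : b < N
      · obtain ⟨π, hπ, hπ'⟩ := (h.window_mem_succ_iff j x _).1 hw
        refine ⟨π ⟨b, hbN⟩, fun _ => ⟨hπ' ⟨b, hbN⟩, fun hP => ?_⟩⟩
        rw [Nat.mod_eq_of_lt hbN] at hP ⊢
        rw [hπ ⟨b, hbN⟩ hP]
      · by_cases hb2 : b < 2 * N
        · obtain ⟨p, rfl⟩ := Nat.exists_eq_add_of_le (not_lt.1 hbN)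
          have hp : p < N := by omega
          obtain ⟨π, hπ, hπ'⟩ := (h.window_mem_succ_iff j x _).1 hw'
          refine ⟨π ⟨p, hp⟩, fun _ => ⟨?_, fun hP => ?_⟩⟩
          · rw [← hπ' ⟨p, hp⟩, hl']
            congr 1
            push_cast
            ring
          · rw [Nat.add_mod_left, Nat.mod_eq_of_lt hp] at hP ⊢
            rw [hπ ⟨p, hp⟩ hP]
        · exact ⟨⟨0, hNj⟩, fun hc => absurd hc hb2⟩
    choose g hg using hblock
    refine Finset.mem_image.2 ⟨⟨⟨t, ht⟩, fun b => g b⟩, Finset.mem_univ _, ?_⟩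
    simp only [dec, window]
    rw [List.ofFn_inj]
    funext k
    have hk := k.2
    have ho := Nat.mod_lt (t + k) hl
    have hdm := Nat.div_add_mod (t + k : ℕ) l
    have hb1 : t / l ≤ (t + k) / l := Nat.div_le_div_right (by omega)
    have hb2 : (t + k) / l ≤ t / l + m := by
      have e1 := Nat.div_add_mod t l
      have e2 := Nat.div_add_mod n l
      have e3 := Nat.mod_lt t hl
      have e4 := Nat.mod_lt n hl
      refine Nat.lt_succ_iff.1 (Nat.div_lt_of_lt_mul ?_)
      have : l * (t / l + m).succ = l * (t / l) + l * (n / l) + l + l := by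
        rw [hm, Nat.succ_eq_add_one]; ring
      omega
    have hb3 : (t + k) / l < 2 * N := by
      refine Nat.div_lt_of_lt_mul ?_
      have : l * (2 * N) = 2 * l' := by rw [hl']; ring
      omega
    obtain ⟨hgw, hgP⟩ := hg ((t + k) / l) hb3
    have hidx : (if hb : (t + k : ℕ) / l ∈ Q t then g ((t + k) / l) else
        ⟨(t + k : ℕ) / l % N, Nat.mod_lt _ hNj⟩) = g ((t + k) / l) := by
      split_ifs with hb
      · rfl
      · refine Fin.ext (hgP fun hP => hb ?_).symm
        simp only [hQ, freeBlocks, Finset.mem_filter, Finset.mem_Icc]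
        exact ⟨⟨hb1, hb2⟩, hb3, hP⟩
    simp only [hidx]
    have hlen : ((C j).get (g ((t + k) / l))).length = l :=
      h.length_of_mem j _ (List.get_mem _ _)
    rw [List.getD_eq_getElem _ _ (by rw [hlen]; exact ho), ← apply_of_window_eq hgw]
    congr 1
    zify at hdm
    push_cast
    linear_combination hdm

lemma exists_blockLength_le_lt (h : IsConstruction l₁ C) (hl₁ : 100 ≤ l₁) {n : ℕ} (hn : l₁ ≤ n) :
    ∃ j, blockLength l₁ C j ≤ n ∧ n < blockLength l₁ C (j + 1) := by
  have hex : ∃ j, n < blockLength l₁ C j := by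
    obtain ⟨j, hj⟩ := ((h.tendsto_blockLength hl₁).eventually_gt_atTop (n : ℝ)).exists
    exact ⟨j, by exact_mod_cast hj⟩
  classical
  have hf := Nat.find_spec hex
  have hmin := fun k => Nat.find_min hex (m := k)
  cases hJ : Nat.find hex with
  | zero =>
    rw [hJ] at hf
    exact absurd hf (not_lt.2 hn)
  | succ j =>
    rw [hJ] at hf
    exact ⟨j, not_lt.1 (hmin j (by omega)), hf⟩

/-- Take `l_j ≤ n < l_{j+1}`. The offset costs `log l_{j+1} ≤ 3√n`, the free blocks cost `(2√m +
4)√l_j ≤ 3√n + 4√n`; hence 10. -/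
lemma exists_window_cover_log_le (h : IsConstruction l₁ C) (hl₁ : 100 ≤ l₁) (hsq : IsSquare l₁)
    (n : ℕ) : ∃ L : Finset Word, l₁ ≤ n →
      Real.log L.card ≤ 10 * √n ∧ ∀ x ∈ subshift C, window x 0 n ∈ L := by
  by_cases hn : l₁ ≤ n
  swap
  · exact ⟨∅, fun hc => absurd hc hn⟩
  obtain ⟨j, hj, hj'⟩ := h.exists_blockLength_le_lt hl₁ hn
  obtain ⟨L, hL, hLw⟩ := h.exists_window_cover (h.two_le_length hl₁) hj'.le
  refine ⟨L, fun _ => ⟨?_, hLw⟩⟩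
  have hl := h.blockLength_pos (h.two_le_length hl₁) j
  have hl' := h.blockLength_pos (h.two_le_length hl₁) (j + 1)
  have hNpos : 0 < (C j).length := lt_of_lt_of_le (by norm_num) (h.two_le_length hl₁ j)
  have h1 := h.log_blockLength_succ_le hl₁ hsq j
  have h2 : Real.log (C j).length ≤ √(blockLength l₁ C j : ℝ) := by
    refine (h.log_length_le hl₁ hsq j).trans (mul_le_of_le_one_right (by positivity) ?_)
    exact pow_le_one₀ (by norm_num) (by norm_num)
  set l := blockLength l₁ C j
  set m := n / l + 1 with hm
  have hlR : (0 : ℝ) < l := by exact_mod_cast hl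
  have hln : √(l : ℝ) ≤ √n := Real.sqrt_le_sqrt (by exact_mod_cast hj)
  have hmn : (Nat.sqrt m : ℝ) * √l ≤ 3 / 2 * √n := by
    have e1 : (Nat.sqrt m : ℝ) ≤ √m := Real.nat_sqrt_le_real_sqrt
    have e2 : (m * l : ℕ) ≤ 2 * n := by
      have := Nat.div_mul_le_self n l
      have : m * l = n / l * l + l := by rw [hm]; ring
      omega
    calc (Nat.sqrt m : ℝ) * √l ≤ √m * √l := by gcongr
      _ = √((m * l : ℕ) : ℝ) := by
        rw [Nat.cast_mul, Real.sqrt_mul (by positivity)]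
      _ ≤ √((3 / 2) ^ 2 * n) := by
        refine Real.sqrt_le_sqrt ?_
        have : ((m * l : ℕ) : ℝ) ≤ 2 * n := by exact_mod_cast e2
        have : (0 : ℝ) ≤ n := by positivity
        linarith
      _ = 3 / 2 * √n := by rw [Real.sqrt_mul (by positivity), Real.sqrt_sq (by norm_num)]
  rcases Nat.eq_zero_or_pos L.card with h0 | h0
  · rw [h0]
    simp
  · have hR : (L.card : ℝ) ≤ blockLength l₁ C (j + 1) *
        ((C j).length : ℝ) ^ (2 * Nat.sqrt m + 4) := by exact_mod_cast hL
    have := Real.log_le_log (by exact_mod_cast h0) hR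
    rw [Real.log_mul (by positivity) (by positivity), Real.log_pow] at this
    have h3 : ((2 * Nat.sqrt m + 4 : ℕ) : ℝ) * Real.log (C j).length ≤
        ((2 * Nat.sqrt m + 4 : ℕ) : ℝ) * √l := by gcongr
    push_cast at h3 this
    have h4 : (2 * (Nat.sqrt m : ℝ) + 4) * √l = 2 * (Nat.sqrt m * √l) + 4 * √l := by ring
    linarith

lemma ae_eventually_log_returnTime_le (h : IsConstruction l₁ C) (hl₁ : 100 ≤ l₁)
    (hsq : IsSquare l₁) [IsProbabilityMeasure μ] (hX : ∀ᵐ x ∂μ, x ∈ subshift C)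
    (hμ : MeasurePreserving shift μ μ) :
    ∀ᵐ x ∂μ, ∀ᶠ n : ℕ in atTop, ∃ K : ℕ, returnTime n x ≤ K ∧ Real.log K ≤ 14 * √n := by
  choose L hL using h.exists_window_cover_log_le hl₁ hsq
  -- The factor `n²` makes the exceptional measures summable and adds `2 log n ≤ 4√n` to the
  -- logarithm; hence 14.
  set K : ℕ → ℕ := fun n => n ^ 2 * (L n).card with hK
  have hbound : ∀ n, μ {x | window x 0 n ∈ L n ∧ (K n : ℕ∞) < returnTime n x} ≤
      -- The extra term covers `n = 0`, where the real quotient is 0 by convention.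
      ENNReal.ofReal (1 / (n : ℝ) ^ 2) + if n = 0 then 1 else 0 := by
    intro n
    rcases Nat.eq_zero_or_pos n with rfl | hn
    · simpa using prob_le_one
    · refine (measure_lt_returnTime_le hμ (L n) n (K n)).trans (le_trans ?_ le_self_add)
      rw [← div_eq_mul_inv]
      have hKpos : (0 : ℝ) < ((K n + 1 : ℕ) : ℝ) := by positivity
      have hKpos' : ((K n + 1 : ℕ) : ENNReal) ≠ 0 := by positivity
      rw [← ENNReal.ofReal_natCast, ← ENNReal.ofReal_natCast (K n + 1),
        ← ENNReal.ofReal_div_of_pos hKpos]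
      refine ENNReal.ofReal_le_ofReal ?_
      rw [div_le_iff₀ hKpos]
      have hnR : (0 : ℝ) < n := by exact_mod_cast hn
      simp only [hK]
      push_cast
      have e : 1 / (n : ℝ) ^ 2 * (n ^ 2 * (L n).card + 1) =
          (L n).card + 1 / (n : ℝ) ^ 2 := by field_simp
      rw [e]
      have : (0 : ℝ) ≤ 1 / (n : ℝ) ^ 2 := by positivity
      linarith
  have hsum : ∑' n, μ {x | window x 0 n ∈ L n ∧ (K n : ℕ∞) < returnTime n x} ≠ ⊤ := by
    refine ne_top_of_le_ne_top ?_ (ENNReal.tsum_le_tsum hbound)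
    rw [ENNReal.tsum_add]
    refine ENNReal.add_ne_top.2 ⟨?_, ?_⟩
    · exact (Real.summable_one_div_nat_pow.2 one_lt_two).tsum_ofReal_ne_top
    · simp
  filter_upwards [ae_eventually_notMem hsum, hX] with x hx hxX
  filter_upwards [hx, eventually_ge_atTop l₁] with n hn hnl
  obtain ⟨hlog, hw⟩ := hL n hnl
  refine ⟨K n, not_lt.1 fun hc => hn ⟨hw x hxX, hc⟩, ?_⟩
  have hn0 : (0 : ℝ) < n := by exact_mod_cast (show 0 < n by omega)
  have h1 := log_le_two_mul_sqrt (n : ℝ) hn0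
  have hc : (0 : ℝ) < (L n).card := by
    exact_mod_cast Finset.card_pos.2 ⟨_, hw x hxX⟩
  simp only [hK]
  push_cast
  rw [Real.log_mul (by positivity) (by positivity), Real.log_pow]
  push_cast
  linarith

end IsConstruction

/-! ### Return rates -/

lemma one_le_returnTime (n : ℕ) (x : ℤ → Bool) : 1 ≤ returnTime n x :=
  le_iInf₂ fun k hk => by exact_mod_cast hk.1

lemma log_natCast_eq {m : ℕ} (hm : 0 < m) :
    ENNReal.log ((m : ℕ∞) : ENNReal) = (Real.log m : EReal) := by
  have : ((m : ℕ∞) : ENNReal) = ENNReal.ofReal m := by simp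
  rw [this, ENNReal.log_ofReal_of_pos (by exact_mod_cast hm)]

lemma returnRate_eq {n m : ℕ} {x : ℤ → Bool} (hm : 0 < m) (h : returnTime n x = m) (β : ℝ) :
    returnRate β n x = ((Real.log m / (n : ℝ) ^ β : ℝ) : EReal) := by
  rw [returnRate, h, log_natCast_eq hm, EReal.coe_div]

lemma returnRate_nonneg (β : ℝ) (n : ℕ) (x : ℤ → Bool) : 0 ≤ returnRate β n x := by
  refine EReal.div_nonneg ?_ (by exact_mod_cast Real.rpow_nonneg (Nat.cast_nonneg n) β)
  rw [← ENNReal.log_one]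
  exact ENNReal.log_monotone (by exact_mod_cast one_le_returnTime n x)

lemma returnRate_le {n m : ℕ} {x : ℤ → Bool} (h : returnTime n x ≤ m) (β : ℝ) :
    returnRate β n x ≤ ((Real.log m / (n : ℝ) ^ β : ℝ) : EReal) := by
  have hm : 0 < m := by exact_mod_cast (one_le_returnTime n x).trans h
  rw [EReal.coe_div, ← log_natCast_eq hm, returnRate]
  refine EReal.div_le_div_right_of_nonneg
    (by exact_mod_cast Real.rpow_nonneg (Nat.cast_nonneg n) β) (ENNReal.log_monotone ?_)
  exact_mod_cast h

/-- The exponent `1 / (2 τ)`, with `τ` replaced by a positive approximation. -/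
noncomputable def scaleExponent (τ : ℝ) (j : ℕ) : ℝ := 1 / (2 * max τ (1 / (j + 1)))

/-- Window lengths along which the return rates have the critical value `τ`. -/
noncomputable def scale (l₁ : ℕ) (C : ℕ → List Word) (τ : ℝ) (j : ℕ) : ℕ :=
  2 * ⌈(blockLength l₁ C j : ℝ) ^ scaleExponent τ j⌉₊

lemma max_pos_of_inv (τ : ℝ) (j : ℕ) : 0 < max τ (1 / (j + 1 : ℝ)) :=
  lt_max_of_lt_right (by positivity)

lemma one_le_scaleExponent {τ : ℝ} (hτ : τ ≤ 1 / 2) {j : ℕ} (hj : 1 ≤ j) :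
    1 ≤ scaleExponent τ j := by
  rw [scaleExponent, le_div_iff₀ (by linarith [max_pos_of_inv τ j])]
  have : (1 : ℝ) / (j + 1) ≤ 1 / 2 := by
    have : (1 : ℝ) ≤ j := by exact_mod_cast hj
    exact one_div_le_one_div_of_le (by norm_num) (by linarith)
  linarith [max_le hτ this]

lemma scaleExponent_le (τ : ℝ) {j : ℕ} (hj : 1 ≤ j) : scaleExponent τ j ≤ j := by
  rw [scaleExponent, div_le_iff₀ (by linarith [max_pos_of_inv τ j])]
  have h1 : (1 : ℝ) / (j + 1) ≤ max τ (1 / (j + 1)) := le_max_right _ _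
  rw [div_le_iff₀ (by positivity)] at h1
  have h2 : (1 : ℝ) ≤ j := by exact_mod_cast hj
  nlinarith [max_pos_of_inv τ j]

lemma eventually_half_le_scaleExponent_mul {τ β : ℝ} (hβ : 0 < β) (hτβ : τ ≤ β) :
    ∀ᶠ j in atTop, 1 / 2 ≤ scaleExponent τ j * β := by
  filter_upwards [tendsto_one_div_add_atTop_nhds_zero_nat.eventually_le_const hβ] with j hj
  have h0 := max_pos_of_inv τ j
  rw [scaleExponent, one_div_mul_eq_div, le_div_iff₀ (by linarith)]
  linarith [max_le hτβ hj]

/-! ### Return rates along the chosen scales. -/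

namespace IsConstruction

variable {l₁ : ℕ} {C : ℕ → List Word}

lemma one_le_blockLength_cast (h : IsConstruction l₁ C) (hl₁ : 100 ≤ l₁) (j : ℕ) :
    (1 : ℝ) ≤ blockLength l₁ C j := by
  exact_mod_cast h.blockLength_pos (h.two_le_length hl₁) j

lemma eventually_le_scale (h : IsConstruction l₁ C) (hl₁ : 100 ≤ l₁) {τ : ℝ} (hτ : τ ≤ 1 / 2) :
    ∀ᶠ j in atTop, 2 * blockLength l₁ C j ≤ scale l₁ C τ j := by
  filter_upwards [eventually_ge_atTop 1] with j hj
  refine Nat.mul_le_mul_left _ ?_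
  have := Real.rpow_le_rpow_of_exponent_le (h.one_le_blockLength_cast hl₁ j)
    (one_le_scaleExponent hτ hj)
  rw [Real.rpow_one] at this
  exact_mod_cast this.trans (Nat.le_ceil _)

lemma tendsto_scale (h : IsConstruction l₁ C) (hl₁ : 100 ≤ l₁) {τ : ℝ} (hτ : τ ≤ 1 / 2) :
    Tendsto (scale l₁ C τ) atTop atTop := by
  refine tendsto_atTop_mono' _ (f₁ := blockLength l₁ C) ?_ ?_
  · filter_upwards [h.eventually_le_scale hl₁ hτ] with j hj
    omega
  · exact tendsto_natCast_atTop_iff.1 (h.tendsto_blockLength hl₁)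

lemma eventually_scale_le (h : IsConstruction l₁ C) (hl₁ : 100 ≤ l₁) (hsq : IsSquare l₁)
    (τ : ℝ) : ∀ᶠ j in atTop,
      scale l₁ C τ j ≤ Nat.sqrt (Nat.sqrt (C j).length) * blockLength l₁ C j := by
  filter_upwards [eventually_ge_atTop 1, h.eventually_pow_le_length hl₁ hsq,
    (h.tendsto_blockLength hl₁).eventually_ge_atTop 2] with j hj hN h2
  have h2' : 2 ≤ blockLength l₁ C j := by exact_mod_cast h2
  have hW : blockLength l₁ C j ^ j ≤ Nat.sqrt (Nat.sqrt (C j).length) := by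
    refine Nat.le_sqrt'.2 (Nat.le_sqrt'.2 ?_)
    rw [← pow_mul, ← pow_mul]
    exact le_trans (le_of_eq (by ring_nf)) hN
  have hc : ⌈(blockLength l₁ C j : ℝ) ^ scaleExponent τ j⌉₊ ≤ blockLength l₁ C j ^ j := by
    refine Nat.ceil_le.2 ?_
    have := Real.rpow_le_rpow_of_exponent_le (h.one_le_blockLength_cast hl₁ j)
      (scaleExponent_le τ hj)
    rw [Real.rpow_natCast] at this
    exact_mod_cast this
  rw [scale, mul_comm]
  -- The factor 2 in the scale is absorbed by `l_j ≥ 2`.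
  exact Nat.mul_le_mul (hc.trans hW) h2'

lemma tendsto_log_div_scale_zero (h : IsConstruction l₁ C) (hl₁ : 100 ≤ l₁) (hsq : IsSquare l₁)
    {τ β : ℝ} (hβ : 0 < β) (hτβ : τ ≤ β) :
    Tendsto (fun j => Real.log (blockLength l₁ C (j + 1)) / (scale l₁ C τ j : ℝ) ^ β)
      atTop (𝓝 0) := by
  refine squeeze_zero' (Eventually.of_forall fun j => ?_) ?_ (h.tendsto_log_div_sqrt hl₁ hsq)
  · exact div_nonneg (Real.log_natCast_nonneg _) (by positivity)
  · filter_upwards [eventually_half_le_scaleExponent_mul hβ hτβ] with j hj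
    have h1 := h.one_le_blockLength_cast hl₁ j
    have h0 : (0 : ℝ) < blockLength l₁ C j := by linarith
    refine div_le_div_of_nonneg_left (Real.log_natCast_nonneg _) (by positivity) ?_
    have h2 : (blockLength l₁ C j : ℝ) ^ scaleExponent τ j ≤ scale l₁ C τ j := by
      have := Nat.le_ceil ((blockLength l₁ C j : ℝ) ^ scaleExponent τ j)
      have h3 : (0 : ℝ) ≤ (blockLength l₁ C j : ℝ) ^ scaleExponent τ j := by positivity
      rw [scale]
      push_cast
      linarith
    calc √(blockLength l₁ C j : ℝ) ≤ (blockLength l₁ C j : ℝ) ^ (scaleExponent τ j * β) := by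
          rw [Real.sqrt_eq_rpow]
          exact Real.rpow_le_rpow_of_exponent_le h1 hj
      _ = ((blockLength l₁ C j : ℝ) ^ scaleExponent τ j) ^ β := Real.rpow_mul h0.le _ _
      _ ≤ _ := Real.rpow_le_rpow (by positivity) h2 hβ.le

lemma tendsto_log_div_scale_top (h : IsConstruction l₁ C) (hl₁ : 100 ≤ l₁) (hsq : IsSquare l₁)
    {τ β : ℝ} (hβ : 0 < β) (hβτ : β < τ) :
    Tendsto (fun j => Real.log (blockLength l₁ C (j + 1)) / (scale l₁ C τ j : ℝ) ^ β)
      atTop atTop := by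
  have hτ : 0 < τ := hβ.trans hβτ
  have hγ : β / (2 * τ) < 1 / 2 := by
    rw [div_lt_div_iff₀ (by linarith) (by norm_num)]
    linarith
  have hlim := (h.tendsto_log_div_rpow hl₁ hsq hγ).const_mul_atTop
    (show (0 : ℝ) < 1 / 4 ^ β by positivity)
  refine tendsto_atTop_mono' _ ?_ hlim
  filter_upwards [tendsto_one_div_add_atTop_nhds_zero_nat.eventually_le_const hτ] with j hj
  have h1 := h.one_le_blockLength_cast hl₁ j
  have h0 : (0 : ℝ) < blockLength l₁ C j := by linarith
  have he : scaleExponent τ j = 1 / (2 * τ) := by rw [scaleExponent, max_eq_left hj]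
  have h2 : (1 : ℝ) ≤ (blockLength l₁ C j : ℝ) ^ scaleExponent τ j :=
    Real.one_le_rpow h1 (by rw [he]; positivity)
  have h3 : (scale l₁ C τ j : ℝ) ≤ 4 * (blockLength l₁ C j : ℝ) ^ scaleExponent τ j := by
    have := (Nat.ceil_lt_add_one
      (show (0 : ℝ) ≤ (blockLength l₁ C j : ℝ) ^ scaleExponent τ j by positivity)).le
    rw [scale]
    push_cast
    linarith
  have h4 : (0 : ℝ) < scale l₁ C τ j := by
    rw [scale]
    exact_mod_cast Nat.mul_pos two_pos (Nat.ceil_pos.2 (by linarith))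
  have h5 : (scale l₁ C τ j : ℝ) ^ β ≤ 4 ^ β * (blockLength l₁ C j : ℝ) ^ (β / (2 * τ)) := by
    refine (Real.rpow_le_rpow h4.le h3 hβ.le).trans (le_of_eq ?_)
    rw [Real.mul_rpow (by norm_num) (by positivity), ← Real.rpow_mul h0.le, he,
      one_div_mul_eq_div]
  rw [one_div_mul_eq_div, div_div, mul_comm _ ((4 : ℝ) ^ β)]
  exact div_le_div_of_nonneg_left (Real.log_natCast_nonneg _) (by positivity) h5

lemma tendsto_returnRate_scale (h : IsConstruction l₁ C) (hl₁ : 100 ≤ l₁) (hsq : IsSquare l₁)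
    {x : ℤ → Bool} (hx : x ∈ subshift C)
    (hs : ∀ᶠ j in atTop, Steady l₁ C j (Nat.sqrt (Nat.sqrt (C j).length)) x) {τ β : ℝ}
    (hτ : τ ≤ 1 / 2) (hβ : 0 < β) :
    Tendsto (fun j => returnRate β (scale l₁ C τ j) x) atTop (𝓝 (if τ ≤ β then 0 else ⊤)) := by
  have hev : (fun j => returnRate β (scale l₁ C τ j) x) =ᶠ[atTop] fun j =>
      ((Real.log (blockLength l₁ C (j + 1)) / (scale l₁ C τ j : ℝ) ^ β : ℝ) : EReal) := by
    filter_upwards [hs, h.eventually_le_scale hl₁ hτ, h.eventually_scale_le hl₁ hsq τ]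
      with j h1 h2 h3
    exact returnRate_eq (h.blockLength_pos (h.two_le_length hl₁) _)
      (h.returnTime_eq_of_steady (h.two_le_length hl₁) hx h1 h2 h3) β
  refine Tendsto.congr' hev.symm ?_
  split_ifs with hc
  · exact (EReal.tendsto_coe (a := 0)).2 (h.tendsto_log_div_scale_zero hl₁ hsq hβ hc)
  · exact EReal.tendsto_coe_nhds_top_iff.2
      (h.tendsto_log_div_scale_top hl₁ hsq hβ (not_le.1 hc))

lemma hasCriticalValue_limsup (h : IsConstruction l₁ C) (hl₁ : 100 ≤ l₁) (hsq : IsSquare l₁)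
    {x : ℤ → Bool} (hx : x ∈ subshift C)
    (hs : ∀ᶠ j in atTop, Steady l₁ C j (Nat.sqrt (Nat.sqrt (C j).length)) x)
    (hlog : ∀ᶠ n : ℕ in atTop, ∃ K : ℕ, returnTime n x ≤ K ∧ Real.log K ≤ 14 * √n) :
    HasCriticalValue (fun β => limsup (fun n : ℕ => returnRate β n x) atTop) (1 / 2) := by
  constructor
  · intro β hβ hβ2
    refine Tendsto.limsup_eq ?_
    have hlim : Tendsto (fun n : ℕ => 14 * (n : ℝ) ^ (-(β - 1 / 2))) atTop (𝓝 0) := by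
      have := ((tendsto_rpow_neg_atTop (sub_pos.2 hβ2)).comp
        tendsto_natCast_atTop_atTop).const_mul (14 : ℝ)
      simpa using this
    refine tendsto_of_tendsto_of_tendsto_of_le_of_le' tendsto_const_nhds
      ((EReal.tendsto_coe (a := 0)).2 hlim) (Eventually.of_forall fun n => returnRate_nonneg β n x)
      ?_
    filter_upwards [hlog, eventually_gt_atTop 0] with n ⟨K, hK, hK'⟩ hn
    refine (returnRate_le hK β).trans (EReal.coe_le_coe_iff.2 ?_)
    have hn0 : (0 : ℝ) < n := by exact_mod_cast hn
    rw [neg_sub, Real.rpow_sub hn0, ← Real.sqrt_eq_rpow, ← mul_div_assoc]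
    gcongr
  · intro β hβ hβ2
    -- The scales for `τ = 1/2` already give infinity along a subsequence, and the limsup dominates
    -- it.
    have hlim := h.tendsto_returnRate_scale hl₁ hsq hx hs le_rfl hβ
    rw [if_neg (not_le.2 hβ2)] at hlim
    rw [← top_le_iff, ← hlim.limsup_eq]
    exact limsup_le_limsup_of_le (u := fun n => returnRate β n x)
      (h.tendsto_scale hl₁ le_rfl)

end IsConstruction

end EntropyDim

theorem mainTheorem3 :
    ∃ L : ℕ, ∀ l₁ : ℕ, L ≤ l₁ → IsSquare l₁ →
      ∀ C : ℕ → List EntropyDim.Word, EntropyDim.IsConstruction l₁ C →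
      ∀ μ : Measure (ℤ → Bool), IsProbabilityMeasure μ →
        (∀ᵐ x ∂μ, x ∈ EntropyDim.subshift C) →
        MeasurePreserving EntropyDim.shift μ μ →
        (∀ᵐ x ∂μ, EntropyDim.HasCriticalValue
          (fun β => limsup (fun n : ℕ => EntropyDim.returnRate β n x) atTop) (1 / 2)) ∧
        (∃ X' : Set (ℤ → Bool), X' ⊆ EntropyDim.subshift C ∧ (∀ᵐ x ∂μ, x ∈ X') ∧
          ∀ τ : ℝ, 0 ≤ τ → τ ≤ 1 / 2 →
            ∃ n : ℕ → ℕ, StrictMono n ∧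
              ∀ x ∈ X', ∃ φ : ℝ → EReal,
                (∀ β : ℝ, 0 < β →
                  Tendsto (fun j : ℕ => EntropyDim.returnRate β (n j) x) atTop (𝓝 (φ β))) ∧
                EntropyDim.HasCriticalValue φ τ) := by
  refine ⟨100, fun l₁ hl₁ hsq C h μ hprob hX hμ => ?_⟩
  have hsteady := h.ae_eventually_steady hl₁ hX hμ
  refine ⟨?_, {x | x ∈ EntropyDim.subshift C ∧ ∀ᶠ j in atTop,
    EntropyDim.Steady l₁ C j (Nat.sqrt (Nat.sqrt (C j).length)) x}, fun x hx => hx.1, ?_, ?_⟩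
  · filter_upwards [hX, hsteady, h.ae_eventually_log_returnTime_le hl₁ hsq hX hμ] with x h1 h2 h3
    exact h.hasCriticalValue_limsup hl₁ hsq h1 h2 h3
  · filter_upwards [hX, hsteady] with x h1 h2
    exact ⟨h1, h2⟩
  · intro τ _ hτ
    -- The scales need not increase strictly, so a subsequence is taken; it depends on `τ` but not
    -- on `x`.
    obtain ⟨ψ, hψ, hmono⟩ := strictMono_subseq_of_tendsto_atTop (h.tendsto_scale hl₁ hτ)
    refine ⟨_, hmono, fun x hx => ⟨fun β => if τ ≤ β then 0 else ⊤, fun β hβ => ?_, ?_, ?_⟩⟩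
    · exact (h.tendsto_returnRate_scale hl₁ hsq hx.1 hx.2 hτ hβ).comp hψ.tendsto_atTop
    · exact fun β _ hβ => if_pos hβ.le
    · exact fun β _ hβ => if_neg (not_le.2 hβ)
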